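/- Let $(\mathbb L;C,\prec)$ be the Fraïssé limit of the class of all finite ordered leaf structures, that is, the countable homogeneous structure whose finite substructures are, up to isomorphism, exactly the finite sets with a binary branching C-relation $C$ (the relations "$y,z$ have their least common ancestor strictly below that of $x,y,z$" on the leaves of finite rooted binary trees) and a convex linear order $\prec$ (if $x\prec y\prec z$ then $xy|z$ or $x|yz$). Here $x|yz$ and $yz|x$ mean $C(x;y,z)$, and for sets $X|Y$ means that $xx'|y$ and $x|yy'$ for all $x,x'\in X$, $y,y'\in Y$; as usual, $x|yzc$ means $\{x\}|\{y,z,c\}$, etc. Let $c\in\mathbb L$ and let $A\subseteq\mathbb L$ satisfy $A\subseteq\{x: x\prec c\}$ or $A\subseteq\{x: c\prec x\}$. Assume that $A$ is $c$-universal: for every finite $U\subset\mathbb L$ and $u\in U$ there is $\alpha\in\mathrm{Aut}(\mathbb L;C)$ with $\alpha(u)=c$ and $\alpha(U)\subseteq A\cup\{c\}$. Let $e:\mathbb L\to\mathbb L$ be an injective function that is canonical on $A$ as a function from $(\mathbb L;C,\prec,c)$ to $(\mathbb L;C,\prec)$: whenever $t$ is a finite tuple of elements of $A\cup\{c\}$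 and $\alpha\in\mathrm{Aut}(\mathbb L;C,\prec,c)$ is such that the entries of $\alpha(t)$ lie in $A\cup\{c\}$, there is $\beta\in\mathrm{Aut}(\mathbb L;C,\prec)$ with $e(\alpha(t))=\beta(e(t))$. Then at least one of the following holds. 1. $\{e\}\cup\mathrm{Aut}(\mathbb L;C)$ generates $\mathrm{lin}$. Here $\mathrm{lin}$ is a function $f:\mathbb L\to\mathbb L$ that preserves $\prec$ and satisfies $f(x)|f(y)f(z)$ whenever $x\prec y\prec z$ (such functions exist, and the claim holds for each of them); a set $M$ of functions generates $f$ if on every finite subset of $\mathbb L$ the function $f$ agrees with some composition of elements of $M$. 2. $e$ behaves on $A$ as $\mathrm{id}_c$. 3. $e$ behaves on $A$ as $\mathrm{reroot}_c$. Here, for $a\in\mathbb L\setminus\{c\}$, let $S^c_a=\{x\ne c: ax|c\}$ be the cone of $a$. Both behaviors require that for all $a,b\in A$: $e(c)|e(A\cap S^c_a)$; $e$ preserves $C$ on $A\cap S^c_a$; and $S^c_a=S^c_b$ or $e(A\cap S^c_a)|e(A\cap S^c_b)$. In addition, for all $x,y,z\in A$ with $x|yzc$ and $y|zc$, the behavior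 $\mathrm{id}_c$ requires $e(x)|e(y)e(z)e(c)$ and $e(y)|e(z)e(c)$, and the behavior $\mathrm{reroot}_c$ requires $e(x)e(y)e(z)|e(c)$ and $e(x)e(y)|e(z)$. -/

import Mathlib

/-! ## Binary branching C-relations, convex orders, and the structure `(𝕃; C, ≺)`

`C x y z` stands for `C(x; y, z)`, also written `x | y z`. -/

/-- A binary branching C-relation. On finite sets these are exactly the relations
"`y` and `z` have their least common ancestor strictly below that of `x, y, z`" on the leaves
of a finite rooted binary tree. -/
structure IsBinaryCRelation {V : Type*} (C : V → V → V → Prop) : Prop where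
  symm : ∀ x y z, C x y z → C x z y
  asymm : ∀ x y z, C x y z → ¬ C y x z
  cut : ∀ x y z w, C x y z → C x w z ∨ C w y z
  self : ∀ x y, x ≠ y → C x y y
  binary : ∀ x y z, x ≠ y → y ≠ z → x ≠ z → C x y z ∨ C y x z ∨ C z x y

/-- A binary branching C-relation with a convex (strict) linear order: in a chain `x ≺ y ≺ z`
either `x y | z` or `x | y z`. On finite sets: the ordered leaf structures. -/
structure IsOrderedLeafStructure {V : Type*} (C : V → V → V → Prop) (lt : V → V → Prop) :
    Prop extends IsBinaryCRelation C where
  irrefl : ∀ x, ¬ lt x x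
  trans : ∀ x y z, lt x y → lt y z → lt x z
  total : ∀ x y, x ≠ y → lt x y ∨ lt y x
  convex : ∀ x y z, lt x y → lt y z → C z x y ∨ C x y z

/-- Automorphisms of `(V; C)`. -/
def IsAutC {V : Type*} (C : V → V → V → Prop) (α : Equiv.Perm V) : Prop :=
  ∀ x y z, C (α x) (α y) (α z) ↔ C x y z

/-- Automorphisms of `(V; C, ≺)`. -/
def IsAutCLt {V : Type*} (C : V → V → V → Prop) (lt : V → V → Prop) (α : Equiv.Perm V) : Prop :=
  IsAutC C α ∧ ∀ x y, lt (α x) (α y) ↔ lt x y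

/-- `(L; C, ≺)` is the Fraïssé limit of the class of all finite ordered leaf structures: it is
countable, its finite substructures are precisely the finite ordered leaf structures up to
isomorphism, and it is homogeneous. This determines `(L; C, ≺)` up to isomorphism, and
`exists_isOrderedLeafLimit` below shows that it exists. -/
structure IsOrderedLeafLimit {L : Type*} (C : L → L → L → Prop) (lt : L → L → Prop) : Prop
    extends IsOrderedLeafStructure C lt where
  countable : Countable L
  universal : ∀ (V : Type) [Finite V] (C' : V → V → V → Prop) (lt' : V → V → Prop),
    IsOrderedLeafStructure C' lt' →
      ∃ f : V → L, (∀ x y z, C (f x) (f y) (f z) ↔ C' x y z) ∧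
        ∀ x y, lt (f x) (f y) ↔ lt' x y
  homogeneous : ∀ (F : Finset L) (f : L → L),
    (∀ x ∈ F, ∀ y ∈ F, ∀ z ∈ F, C (f x) (f y) (f z) ↔ C x y z) →
    (∀ x ∈ F, ∀ y ∈ F, lt (f x) (f y) ↔ lt x y) →
      ∃ α : Equiv.Perm L, IsAutCLt C lt α ∧ ∀ x ∈ F, α x = f x

/-! ## Cones, universal sets, canonical functions, behaviors, generation -/

section Behaviors

variable {L : Type*}

/-- `X | Y` for sets: `x x' | y` and `x | y y'` for all `x, x' ∈ X` and `y, y' ∈ Y`. -/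
def SetSep (C : L → L → L → Prop) (X Y : Set L) : Prop :=
  (∀ x ∈ X, ∀ x' ∈ X, ∀ y ∈ Y, C y x x') ∧ (∀ x ∈ X, ∀ y ∈ Y, ∀ y' ∈ Y, C x y y')

/-- The cone `S^c_a` of `(L; C, c)`: the elements `x ≠ c` with `a x | c`. -/
def cone (C : L → L → L → Prop) (c a : L) : Set L := {x | x ≠ c ∧ C c a x}

/-- `A ⊆ L ∖ {c}` is `c`-universal. -/
def IsUniversalAt (C : L → L → L → Prop) (c : L) (A : Set L) : Prop :=
  c ∉ A ∧ ∀ (U : Finset L), ∀ u ∈ U, ∃ α : Equiv.Perm L, IsAutC C α ∧ α u = c ∧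
    ∀ x ∈ U, α x ∈ insert c A

/-- `f` is canonical on `S` with respect to the permutation groups given by `G` (source) and
`H` (target): if two finite tuples of elements of `S` lie in the same orbit under `G`, then
their images under `f` lie in the same orbit under `H`. -/
def CanonicalOn (G H : Equiv.Perm L → Prop) (f : L → L) (S : Set L) : Prop :=
  ∀ (n : ℕ) (t : Fin n → L), (∀ i, t i ∈ S) → ∀ α, G α → (∀ i, α (t i) ∈ S) →
    ∃ β, H β ∧ ∀ i, f (α (t i)) = β (f (t i))

/-- `f` is canonical on `A` as a function from `(L; C, ≺, c)` to `(L; C, ≺)`. Since `c` is a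
constant of the source structure, it may occur in the tuples together with elements of `A`. -/
def CanonicalOnWithConst (C : L → L → L → Prop) (lt : L → L → Prop) (c : L) (f : L → L)
    (A : Set L) : Prop :=
  CanonicalOn (fun α => IsAutCLt C lt α ∧ α c = c) (IsAutCLt C lt) f (insert c A)

/-- The conditions common to all behaviors with one constant. -/
structure OneConstBehavior (C : L → L → L → Prop) (c : L) (e : L → L) (A : Set L) : Prop where
  sep_const : ∀ a ∈ A, SetSep C {e c} (e '' (A ∩ cone C c a))
  preserves : ∀ a ∈ A, ∀ x ∈ A ∩ cone C c a, ∀ y ∈ A ∩ cone C c a, ∀ z ∈ A ∩ cone C c a,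
    C x y z → C (e x) (e y) (e z)
  sep_cones : ∀ a ∈ A, ∀ b ∈ A, cone C c a = cone C c b ∨
    SetSep C (e '' (A ∩ cone C c a)) (e '' (A ∩ cone C c b))

/-- `e` behaves as `id_c` on `A`. -/
structure BehavesAsId (C : L → L → L → Prop) (c : L) (e : L → L) (A : Set L) : Prop
    extends OneConstBehavior C c e A where
  id_rule : ∀ x ∈ A, ∀ y ∈ A, ∀ z ∈ A, SetSep C {x} {y, z, c} → C y z c →
    SetSep C {e x} {e y, e z, e c} ∧ C (e y) (e z) (e c)

/-- `e` behaves as `reroot_c` on `A`. -/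
structure BehavesAsReroot (C : L → L → L → Prop) (c : L) (e : L → L) (A : Set L) : Prop
    extends OneConstBehavior C c e A where
  reroot_rule : ∀ x ∈ A, ∀ y ∈ A, ∀ z ∈ A, SetSep C {x} {y, z, c} → C y z c →
    SetSep C {e x, e y, e z} {e c} ∧ C (e z) (e x) (e y)

/-- `M` generates `f`: on every finite set, `f` agrees with a composition of elements of `M`
(i.e. `f` is in the closure of the monoid generated by `M` in the topology of pointwise
convergence). -/
def Generates (M : Set (Function.End L)) (f : L → L) : Prop :=
  ∀ F : Finset L, ∃ g ∈ Submonoid.closure M, ∀ x ∈ F, g x = f x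

/-- `f` is a function `lin`: it preserves `≺` and behaves as `lin`, that is,
`f(x) | f(y) f(z)` whenever `x ≺ y ≺ z`. -/
def IsLin (C : L → L → L → Prop) (lt : L → L → Prop) (f : L → L) : Prop :=
  (∀ x y, lt x y → lt (f x) (f y)) ∧
    ∀ x y z, lt x y → lt y z → C (f x) (f y) (f z)

/-- `M` generates `lin`. A function `lin` is not unique; we ask that one exists and that every
one of them is generated. -/
def GeneratesLin (C : L → L → L → Prop) (lt : L → L → Prop) (M : Set (Function.End L)) : Prop :=
  (∃ f : L → L, IsLin C lt f) ∧ ∀ f : L → L, IsLin C lt f → Generates M f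

/-- The functions in `Aut(L; C)`. -/
def autC (C : L → L → L → Prop) : Set (Function.End L) :=
  {f | ∃ α : Equiv.Perm L, IsAutC C α ∧ f = (α : L → L)}

end Behaviors

/-! ## Existence of `(𝕃; C, ≺)`

A concrete model: finite sets of rationals, read as branches of a binary tree with rational
levels. `x` and `y` split at the least level `r` at which they differ; the branch containing
`r` lies to the left if and only if `r` is dyadic. -/

namespace OrderedLeafModel

section Abstract

variable {V : Type*} {C : V → V → V → Prop} {lt : V → V → Prop}

theorem rel_xbb (h : IsBinaryCRelation C) {x a b b' : V}
    (hb : C x a b ∨ C b a x) (hb' : C x a b' ∨ C b' a x) :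
    C x b b' ↔ (C x a b ∧ C x a b') ∨ (¬ C x a b ∧ ¬ C x a b' ∧ C a b b') := by
  obtain ⟨h1, h2, h3, h4, h5⟩ := h
  grind

theorem rel_bxb (h : IsBinaryCRelation C) {x a b b' : V}
    (hb : C x a b ∨ C b a x) (hb' : C x a b' ∨ C b' a x) :
    C b x b' ↔ ¬ C x a b ∧ (C x a b' ∨ C b a b') := by
  obtain ⟨h1, h2, h3, h4, h5⟩ := h
  grind

theorem exists_closest (h : IsBinaryCRelation C) (x : V) {T : Finset V} (hT : T.Nonempty) :
    ∃ p ∈ T, ∀ q ∈ T, ¬ C p x q := by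
  obtain ⟨h1, h2, h3, h4, h5⟩ := h
  induction hT using Finset.Nonempty.cons_induction with
  | singleton a =>
    refine ⟨a, by simp, ?_⟩
    intro q hq
    rw [Finset.mem_singleton.1 hq]
    grind
  | cons a s ha hs ih =>
    obtain ⟨p, hp, hq⟩ := ih
    by_cases hpa : C p x a
    · refine ⟨a, by simp, ?_⟩
      intro q hqs
      rcases Finset.mem_cons.1 hqs with rfl | hqs
      · grind
      · have := hq q hqs
        grind
    · refine ⟨p, by simp [hp], ?_⟩
      grind

theorem lt_iff_of_near (h : IsOrderedLeafStructure C lt) {x a b : V} (hb : C x a b) :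
    (lt x b ↔ lt x a) ∧ (lt b x ↔ lt a x) := by
  obtain ⟨⟨h1, h2, h3, h4, h5⟩, g1, g2, g3, g4⟩ := h
  have hxa : x ≠ a := by grind
  have hxb : x ≠ b := by grind
  have := g3 x a hxa
  have := g3 x b hxb
  grind

variable {W : Type*} {C' : W → W → W → Prop} {lt' : W → W → Prop}

/-- Finite partial isomorphisms, as sets of pairs. -/
def IsPartialIso (C : V → V → V → Prop) (lt : V → V → Prop) (C' : W → W → W → Prop)
    (lt' : W → W → Prop) (S : Finset (V × W)) : Prop :=
  (∀ p ∈ S, ∀ q ∈ S, ∀ r ∈ S, C p.1 q.1 r.1 ↔ C' p.2 q.2 r.2) ∧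
    ∀ p ∈ S, ∀ q ∈ S, lt p.1 q.1 ↔ lt' p.2 q.2

/-- One can branch off from `a` on either side, between the elements far from `a` and those
near `a`. -/
def Branching (C : W → W → W → Prop) (lt : W → W → Prop) : Prop :=
  ∀ (a : W) (O G : Finset W), (∀ b ∈ O, b ≠ a) → (∀ b ∈ O, ∀ g ∈ G, C b a g) → ∀ side : Prop,
    ∃ y, y ≠ a ∧ (∀ b ∈ O, C b a y) ∧ (∀ g ∈ G, C y a g) ∧ (lt y a ↔ side)

theorem extend [DecidableEq V] [DecidableEq W] [Nonempty W]
    (h : IsOrderedLeafStructure C lt) (h' : IsOrderedLeafStructure C' lt')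
    (hbr : Branching C' lt') {S : Finset (V × W)} (hS : IsPartialIso C lt C' lt' S) (x : V) :
    ∃ y, IsPartialIso C lt C' lt' (insert (x, y) S) := by
  classical
  by_cases hx : ∃ p ∈ S, p.1 = x
  · obtain ⟨p, hp, rfl⟩ := hx
    exact ⟨p.2, by simpa [Finset.insert_eq_of_mem hp] using hS⟩
  push Not at hx
  have hC0 : ∀ z w, ¬ C z z w := fun z w hz => h.asymm _ _ _ hz hz
  have hC1 : ∀ z w, ¬ C z w z := fun z w hz => hC0 _ _ (h.symm _ _ _ hz)
  have hC0' : ∀ z w, ¬ C' z z w := fun z w hz => h'.asymm _ _ _ hz hz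
  have hC1' : ∀ z w, ¬ C' z w z := fun z w hz => hC0' _ _ (h'.symm _ _ _ hz)
  rcases S.eq_empty_or_nonempty with rfl | hne
  · refine ⟨Classical.arbitrary W, ?_, ?_⟩
    · simp [hC0, hC0']
    · simp [h.irrefl, h'.irrefl]
  obtain ⟨a0, ha0, hclosest⟩ := exists_closest h.toIsBinaryCRelation x (hne.image Prod.fst)
  obtain ⟨a, ha, rfl⟩ := Finset.mem_image.1 ha0
  have hfar : ∀ p ∈ S, ¬ C a.1 x p.1 := fun p hp => hclosest _ (Finset.mem_image_of_mem _ hp)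
  have hGO : ∀ p ∈ S, C x a.1 p.1 ∨ C p.1 a.1 x := by
    intro p hp
    have e1 := hfar p hp
    have e2 := hx p hp
    have e3 := hx a ha
    by_cases hpa : p.1 = a.1
    · left
      rw [hpa]
      exact h.self _ _ (Ne.symm e3)
    · rcases h.binary x a.1 p.1 (Ne.symm e3) (Ne.symm hpa) (Ne.symm e2) with h0 | h0 | h0
      · exact Or.inl h0
      · exact absurd h0 e1
      · exact Or.inr (h.symm _ _ _ h0)
  obtain ⟨y, hya, hyO, hyG, hyl⟩ := hbr a.2 ((S.filter fun p => ¬ C x a.1 p.1).image Prod.snd)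
    ((S.filter fun p => C x a.1 p.1).image Prod.snd)
    (by
      intro b hb hba
      obtain ⟨p, hp, rfl⟩ := Finset.mem_image.1 hb
      obtain ⟨hp, hpx⟩ := Finset.mem_filter.1 hp
      have h0 : C p.1 a.1 a.1 := by
        rcases hGO p hp with h0 | h0
        · exact absurd h0 hpx
        · apply h.self
          rintro e
          rw [e] at h0
          exact hC0 _ _ h0
      have := (hS.1 p hp a ha a ha).1 h0
      rw [hba] at this
      exact hC0' _ _ this)
    (by
      intro b hb g hg
      obtain ⟨p, hp, rfl⟩ := Finset.mem_image.1 hb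
      obtain ⟨hp, hpx⟩ := Finset.mem_filter.1 hp
      obtain ⟨q, hq, rfl⟩ := Finset.mem_image.1 hg
      obtain ⟨hq, hqx⟩ := Finset.mem_filter.1 hq
      rw [← hS.1 p hp a ha q hq]
      obtain ⟨h1, h2, h3, h4, h5⟩ := h.toIsBinaryCRelation
      have := hGO p hp
      grind) (lt x a.1)
  have hO : ∀ p ∈ S, ¬ C x a.1 p.1 → C' p.2 a.2 y := fun p hp hpx =>
    hyO _ (Finset.mem_image_of_mem _ (Finset.mem_filter.2 ⟨hp, hpx⟩))
  have hG : ∀ p ∈ S, C x a.1 p.1 → C' y a.2 p.2 := fun p hp hpx =>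
    hyG _ (Finset.mem_image_of_mem _ (Finset.mem_filter.2 ⟨hp, hpx⟩))
  have hGO' : ∀ p ∈ S, C' y a.2 p.2 ∨ C' p.2 a.2 y := by
    intro p hp
    by_cases hpx : C x a.1 p.1
    · exact Or.inl (hG p hp hpx)
    · exact Or.inr (hO p hp hpx)
  have hiff : ∀ p ∈ S, (C x a.1 p.1 ↔ C' y a.2 p.2) := by
    intro p hp
    refine ⟨hG p hp, fun h0 => ?_⟩
    by_contra hpx
    have h1 := hO p hp hpx
    exact h'.asymm _ _ _ (h'.symm _ _ _ h1) (h'.symm _ _ _ h0)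
  have hxne : ∀ p ∈ S, p.1 ≠ x := hx
  have hyne : ∀ p ∈ S, p.2 ≠ y := by
    rintro p hp rfl
    rcases hGO' p hp with h0 | h0
    · exact hC1' _ _ h0
    · exact hC1' _ _ h0
  have hxl : ∀ p ∈ S, (lt x p.1 ↔ lt' y p.2) ∧ (lt p.1 x ↔ lt' p.2 y) := by
    have hal : (lt x a.1 ↔ lt' y a.2) ∧ (lt a.1 x ↔ lt' a.2 y) := by
      refine ⟨hyl.symm, ?_⟩
      have e1 := h.total x a.1 (Ne.symm (hx a ha))
      have e2 := h'.total y a.2 hya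
      have e3 : lt x a.1 → ¬ lt a.1 x := fun u v => h.irrefl _ (h.trans _ _ _ u v)
      have e4 : lt' y a.2 → ¬ lt' a.2 y := fun u v => h'.irrefl _ (h'.trans _ _ _ u v)
      constructor
      · exact fun u => e2.resolve_left fun v => e3 (hyl.1 v) u
      · exact fun u => e1.resolve_left fun v => e4 (hyl.2 v) u
    intro p hp
    by_cases hpx : C x a.1 p.1
    · have e1 := lt_iff_of_near h hpx
      have e2 := lt_iff_of_near h' (hG p hp hpx)
      rw [e1.1, e1.2, e2.1, e2.2]
      exact hal
    · have e1 := lt_iff_of_near h ((hGO p hp).resolve_left hpx)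
      have e2 := lt_iff_of_near h' (hO p hp hpx)
      rw [e1.1, e1.2, e2.1, e2.2]
      exact ⟨hS.2 a ha p hp, hS.2 p hp a ha⟩
  have k1 : ∀ p ∈ S, ∀ q ∈ S, (C x p.1 q.1 ↔ C' y p.2 q.2) := by
    intro p hp q hq
    rw [rel_xbb h.toIsBinaryCRelation (hGO p hp) (hGO q hq),
      rel_xbb h'.toIsBinaryCRelation (hGO' p hp) (hGO' q hq), hiff p hp, hiff q hq,
      hS.1 a ha p hp q hq]
  have k2 : ∀ p ∈ S, ∀ q ∈ S, (C p.1 x q.1 ↔ C' p.2 y q.2) := by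
    intro p hp q hq
    rw [rel_bxb h.toIsBinaryCRelation (hGO p hp) (hGO q hq),
      rel_bxb h'.toIsBinaryCRelation (hGO' p hp) (hGO' q hq), hiff p hp, hiff q hq,
      hS.1 p hp a ha q hq]
  have k3 : ∀ p ∈ S, ∀ q ∈ S, (C p.1 q.1 x ↔ C' p.2 q.2 y) := by
    intro p hp q hq
    have e1 : C p.1 q.1 x ↔ C p.1 x q.1 := ⟨h.symm _ _ _, h.symm _ _ _⟩
    have e2 : C' p.2 q.2 y ↔ C' p.2 y q.2 := ⟨h'.symm _ _ _, h'.symm _ _ _⟩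
    rw [e1, e2, k2 p hp q hq]
  refine ⟨y, ?_, ?_⟩
  · intro p hp q hq r hr
    rcases Finset.mem_insert.1 hp with rfl | hp <;> rcases Finset.mem_insert.1 hq with rfl | hq <;>
      rcases Finset.mem_insert.1 hr with rfl | hr
    · simp [hC0, hC0']
    · simp [hC0, hC0']
    · simp [hC1, hC1']
    · exact k1 q hq r hr
    · exact iff_of_true (h.self _ _ (hxne p hp)) (h'.self _ _ (hyne p hp))
    · exact k2 p hp r hr
    · exact k3 p hp q hq
    · exact hS.1 p hp q hq r hr
  · intro p hp q hq
    rcases Finset.mem_insert.1 hp with rfl | hp <;> rcases Finset.mem_insert.1 hq with rfl | hq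
    · simp [h.irrefl, h'.irrefl]
    · exact (hxl q hq).1
    · exact (hxl p hp).2
    · exact hS.2 p hp q hq

theorem exists_embedding [DecidableEq V] [DecidableEq W] [Nonempty W] [Finite V]
    (h : IsOrderedLeafStructure C lt) (h' : IsOrderedLeafStructure C' lt')
    (hbr : Branching C' lt') :
    ∃ f : V → W, (∀ x y z, C' (f x) (f y) (f z) ↔ C x y z) ∧
        ∀ x y, lt' (f x) (f y) ↔ lt x y := by
  have key : ∀ T : Finset V, ∃ S : Finset (V × W), IsPartialIso C lt C' lt' S ∧
      ∀ x ∈ T, ∃ y, (x, y) ∈ S := by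
    intro T
    induction T using Finset.induction_on with
    | empty => exact ⟨∅, by simp [IsPartialIso], by simp⟩
    | insert a s _ ih =>
      obtain ⟨S, hS, hT⟩ := ih
      obtain ⟨y, hy⟩ := extend h h' hbr hS a
      refine ⟨_, hy, ?_⟩
      intro x hx
      rcases Finset.mem_insert.1 hx with rfl | hx
      · exact ⟨y, by simp⟩
      · obtain ⟨z, hz⟩ := hT x hx
        exact ⟨z, by simp [hz]⟩
  have := Fintype.ofFinite V
  obtain ⟨S, hS, hT⟩ := key Finset.univ
  choose f hf using fun x => hT x (Finset.mem_univ x)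
  exact ⟨f, fun x y z => (hS.1 _ (hf x) _ (hf y) _ (hf z)).symm,
    fun x y => (hS.2 _ (hf x) _ (hf y)).symm⟩

theorem IsPartialIso.swap [DecidableEq V] [DecidableEq W] {S : Finset (V × W)}
    (hS : IsPartialIso C lt C' lt' S) :
    IsPartialIso C' lt' C lt (S.image Prod.swap) := by
  constructor
  · intro p hp q hq r hr
    simp only [Finset.mem_image, Prod.exists, Prod.swap_prod_mk] at hp hq hr
    obtain ⟨a, b, hp, rfl⟩ := hp
    obtain ⟨a', b', hq, rfl⟩ := hq
    obtain ⟨a'', b'', hr, rfl⟩ := hr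
    exact (hS.1 _ hp _ hq _ hr).symm
  · intro p hp q hq
    simp only [Finset.mem_image, Prod.exists, Prod.swap_prod_mk] at hp hq
    obtain ⟨a, b, hp, rfl⟩ := hp
    obtain ⟨a', b', hq, rfl⟩ := hq
    exact (hS.2 _ hp _ hq).symm

theorem extend_right [DecidableEq V] [Nonempty V]
    (h : IsOrderedLeafStructure C lt) (hbr : Branching C lt)
    {S : Finset (V × V)} (hS : IsPartialIso C lt C lt S) (y : V) :
    ∃ x, IsPartialIso C lt C lt (insert (x, y) S) := by
  obtain ⟨x, hx⟩ := extend h h hbr hS.swap y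
  refine ⟨x, ?_⟩
  have := hx.swap
  rwa [Finset.image_insert, Finset.image_image, Prod.swap_swap_eq, Finset.image_id] at this

theorem exists_automorphism [DecidableEq V] [Nonempty V] [Countable V]
    (h : IsOrderedLeafStructure C lt) (hbr : Branching C lt)
    {S : Finset (V × V)} (hS : IsPartialIso C lt C lt S) :
    ∃ α : Equiv.Perm V, IsAutCLt C lt α ∧ ∀ p ∈ S, α p.1 = p.2 := by
  classical
  obtain ⟨en, hen⟩ := exists_surjective_nat V
  have step : ∀ (T : {T : Finset (V × V) // IsPartialIso C lt C lt T}) (x : V),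
      ∃ T' : {T : Finset (V × V) // IsPartialIso C lt C lt T},
        T.1 ⊆ T'.1 ∧ (∃ y, (x, y) ∈ T'.1) ∧ ∃ y, (y, x) ∈ T'.1 := by
    rintro ⟨T, hT⟩ x
    obtain ⟨y, hy⟩ := extend h h hbr hT x
    obtain ⟨z, hz⟩ := extend_right h hbr hy x
    refine ⟨⟨_, hz⟩, ?_, ⟨y, by simp⟩, ⟨z, by simp⟩⟩
    intro p hp
    simp [hp]
  choose nxt n1 n2 n3 using step
  let chain : ℕ → {T : Finset (V × V) // IsPartialIso C lt C lt T} :=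
    fun n => Nat.rec ⟨S, hS⟩ (fun k T => nxt T (en k)) n
  have hmono : Monotone fun n => (chain n).1 := monotone_nat_of_le_succ fun n => n1 _ _
  have hcommon : ∀ p q r : V × V, (∃ n, p ∈ (chain n).1) → (∃ n, q ∈ (chain n).1) →
      (∃ n, r ∈ (chain n).1) →
      ((C p.1 q.1 r.1 ↔ C p.2 q.2 r.2) ∧ (lt p.1 q.1 ↔ lt p.2 q.2)) := by
    rintro p q r ⟨i, hi⟩ ⟨j, hj⟩ ⟨k, hk⟩
    have e1 := hmono (le_max_left i (max j k)) hi
    have e2 := hmono ((le_max_left j k).trans (le_max_right i (max j k))) hj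
    have e3 := hmono ((le_max_right j k).trans (le_max_right i (max j k))) hk
    have := (chain (max i (max j k))).2
    exact ⟨this.1 _ e1 _ e2 _ e3, this.2 _ e1 _ e2⟩
  have hdom : ∀ x, ∃ y, ∃ n, (x, y) ∈ (chain n).1 := by
    intro x
    obtain ⟨k, rfl⟩ := hen x
    obtain ⟨y, hy⟩ := n2 (chain k) (en k)
    exact ⟨y, k + 1, hy⟩
  have hran : ∀ y, ∃ x, ∃ n, (x, y) ∈ (chain n).1 := by
    intro y
    obtain ⟨k, rfl⟩ := hen y
    obtain ⟨x, hx⟩ := n3 (chain k) (en k)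
    exact ⟨x, k + 1, hx⟩
  have heq : ∀ p q : V × V, (∃ n, p ∈ (chain n).1) → (∃ n, q ∈ (chain n).1) →
      (p.1 = q.1 ↔ p.2 = q.2) := by
    intro p q hp hq
    have e1 := (hcommon p q q hp hq hq).2
    have e2 := (hcommon q p p hq hp hp).2
    have i1 := h.irrefl
    constructor
    · intro e
      by_contra hne
      rcases h.total _ _ hne with hh | hh
      · exact i1 _ (e ▸ e1.2 hh)
      · exact i1 _ (e ▸ e2.2 hh)
    · intro e
      by_contra hne
      rcases h.total _ _ hne with hh | hh
      · exact i1 _ (e ▸ e1.1 hh)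
      · exact i1 _ (e ▸ e2.1 hh)
  choose f hf using hdom
  choose g hg using hran
  refine ⟨⟨f, g, fun x => (heq _ _ (hg (f x)) (hf x)).2 rfl,
    fun y => (heq _ _ (hf (g y)) (hg y)).1 rfl⟩, ⟨?_, ?_⟩, ?_⟩
  · exact fun x y z => ((hcommon _ _ _ (hf x) (hf y) (hf z)).1).symm
  · exact fun x y => ((hcommon _ _ _ (hf x) (hf y) (hf y)).2).symm
  · exact fun p hp => (heq _ _ (hf p.1) ⟨0, hp⟩).1 rfl

theorem isOrderedLeafLimit_of_branching [Nonempty V] [Countable V]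
    (h : IsOrderedLeafStructure C lt) (hbr : Branching C lt) : IsOrderedLeafLimit C lt := by
  classical
  refine ⟨h, inferInstance, ?_, ?_⟩
  · intro U _ C' lt' h'
    exact exists_embedding h' h hbr
  · intro F f hC hl
    obtain ⟨α, hα, he⟩ := exists_automorphism h hbr (S := F.image fun x => (x, f x)) (by
      constructor
      · intro p hp q hq r hr
        obtain ⟨x, hx, rfl⟩ := Finset.mem_image.1 hp
        obtain ⟨y, hy, rfl⟩ := Finset.mem_image.1 hq
        obtain ⟨z, hz, rfl⟩ := Finset.mem_image.1 hr
        exact (hC x hx y hy z hz).symm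
      · intro p hp q hq
        obtain ⟨x, hx, rfl⟩ := Finset.mem_image.1 hp
        obtain ⟨y, hy, rfl⟩ := Finset.mem_image.1 hq
        exact (hl x hx y hy).symm)
    exact ⟨α, hα, fun x hx => he (x, f x) (Finset.mem_image_of_mem (fun x => (x, f x)) hx)⟩

end Abstract

section Model

/-- `x` and `y` agree below level `r` and differ at `r`. -/
def SplitAt (x y : Finset ℚ) (r : ℚ) : Prop :=
  (∀ s < r, s ∈ x ↔ s ∈ y) ∧ ¬ (r ∈ x ↔ r ∈ y)

/-- `r` is dyadic. -/
def IsDyadicRat (r : ℚ) : Prop := ∃ (k : ℤ) (n : ℕ), r = k / 2 ^ n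

def modelC (x y z : Finset ℚ) : Prop := ∃ r, SplitAt x y r ∧ ∀ s ≤ r, s ∈ y ↔ s ∈ z

def modelLt (x y : Finset ℚ) : Prop := ∃ r, SplitAt x y r ∧ (r ∈ x ↔ IsDyadicRat r)

theorem exists_splitAt {x y : Finset ℚ} (h : x ≠ y) : ∃ r, SplitAt x y r := by
  have hne : (symmDiff x y).Nonempty := by
    rw [Finset.nonempty_iff_ne_empty]
    intro e
    exact h (symmDiff_eq_bot.1 e)
  refine ⟨(symmDiff x y).min' hne, ?_, ?_⟩
  · intro s hs
    by_contra hc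
    have : s ∈ symmDiff x y := by
      rw [Finset.mem_symmDiff]
      tauto
    exact absurd (Finset.min'_le _ _ this) (not_le.2 hs)
  · have := Finset.min'_mem _ hne
    rw [Finset.mem_symmDiff] at this
    tauto

theorem model_ordered : IsOrderedLeafStructure modelC modelLt := by
  refine ⟨⟨?_, ?_, ?_, ?_, ?_⟩, ?_, ?_, ?_, ?_⟩
  · rintro x y z ⟨r, ⟨h1, h2⟩, h3⟩
    refine ⟨r, ⟨?_, ?_⟩, ?_⟩ <;> grind
  · rintro x y z ⟨r, ⟨h1, h2⟩, h3⟩ ⟨r', ⟨h1', h2'⟩, h3'⟩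
    rcases lt_trichotomy r r' with h | h | h <;> grind
  · rintro x y z w ⟨r, ⟨h1, h2⟩, h3⟩
    by_cases hw : ∀ s ≤ r, s ∈ w ↔ s ∈ z
    · left
      refine ⟨r, ⟨?_, ?_⟩, ?_⟩ <;> grind
    · right
      have hwy : w ≠ y := by
        rintro rfl
        exact hw h3
      obtain ⟨t, h4, h5⟩ := exists_splitAt hwy
      have : t ≤ r := by
        by_contra ht
        push Not at ht
        apply hw
        intro s hs
        rw [h4 s (lt_of_le_of_lt hs ht), h3 s hs]
      exact ⟨t, ⟨h4, h5⟩, fun s hs => h3 s (hs.trans this)⟩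
  · intro x y hxy
    obtain ⟨r, hr⟩ := exists_splitAt hxy
    exact ⟨r, hr, fun _ _ => Iff.rfl⟩
  · intro x y z hxy hyz hxz
    obtain ⟨r, h1, h2⟩ := exists_splitAt hxy
    obtain ⟨t, h3, h4⟩ := exists_splitAt hyz
    rcases lt_trichotomy r t with h | h | h
    · left
      exact ⟨r, ⟨h1, h2⟩, fun s hs => h3 s (lt_of_le_of_lt hs h)⟩
    · subst h
      right; left
      refine ⟨r, ⟨?_, ?_⟩, ?_⟩
      · grind
      · grind
      · intro s hs
        rcases lt_or_eq_of_le hs with hs | rfl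
        · grind
        · tauto
    · right; right
      refine ⟨t, ⟨?_, ?_⟩, ?_⟩ <;> grind
  · rintro x ⟨r, ⟨h1, h2⟩, h3⟩
    exact h2 Iff.rfl
  · rintro x y z ⟨r, ⟨h1, h2⟩, h3⟩ ⟨t, ⟨h4, h5⟩, h6⟩
    rcases lt_trichotomy r t with h | h | h
    · exact ⟨r, ⟨by grind, by grind⟩, h3⟩
    · subst h
      tauto
    · refine ⟨t, ⟨by grind, by grind⟩, by grind⟩
  · intro x y hxy
    obtain ⟨r, h1, h2⟩ := exists_splitAt hxy
    by_cases h : r ∈ x ↔ IsDyadicRat r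
    · exact Or.inl ⟨r, ⟨h1, h2⟩, h⟩
    · exact Or.inr ⟨r, ⟨fun s hs => (h1 s hs).symm, by tauto⟩, by tauto⟩
  · rintro x y z ⟨r, ⟨h1, h2⟩, h3⟩ ⟨t, ⟨h4, h5⟩, h6⟩
    rcases lt_trichotomy r t with h | h | h
    · exact Or.inr ⟨r, ⟨h1, h2⟩, fun s hs => h4 s (lt_of_le_of_lt hs h)⟩
    · subst h
      tauto
    · left
      refine ⟨t, ⟨by grind, by grind⟩, by grind⟩

theorem exists_dyadic_iff {p q : ℚ} (hpq : p < q) (P : Prop) :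
    ∃ s, p < s ∧ s < q ∧ (IsDyadicRat s ↔ P) := by
  obtain ⟨n, hn⟩ := exists_pow_lt_of_lt_one (y := (1 / 2 : ℚ)) (x := (q - p) / 2)
    (by linarith) (by norm_num)
  have h2 : (0 : ℚ) < 2 ^ n := by positivity
  rw [one_div, inv_pow, inv_lt_comm₀ h2 (by linarith)] at hn
  have hn' : 2 < (q - p) * 2 ^ n := by
    rw [inv_lt_iff_one_lt_mul₀ (by linarith)] at hn
    linarith
  have hk1 := Int.lt_floor_add_one (p * 2 ^ n)
  have hk2 := Int.floor_le (p * 2 ^ n)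
  set k := ⌊p * 2 ^ n⌋
  by_cases hP : P
  · refine ⟨(k + 1) / 2 ^ n, ?_, ?_, ?_⟩
    · rw [lt_div_iff₀ h2]; exact hk1
    · rw [div_lt_iff₀ h2]; linarith
    · simp only [hP, iff_true]
      exact ⟨k + 1, n, by push_cast; rfl⟩
  · refine ⟨(k + 1 + 1 / 3) / 2 ^ n, ?_, ?_, ?_⟩
    · rw [lt_div_iff₀ h2]; linarith
    · rw [div_lt_iff₀ h2]; linarith
    · simp only [hP, iff_false]
      rintro ⟨m, j, hm⟩
      have hj : (0 : ℚ) < 2 ^ j := by positivity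
      rw [div_eq_div_iff h2.ne' hj.ne'] at hm
      have hz : (3 * k + 4) * 2 ^ j = 3 * (m * 2 ^ n) := by
        have : ((3 * k + 4) * 2 ^ j : ℚ) = 3 * (m * 2 ^ n) := by linarith
        exact_mod_cast this
      have h3 : (3 : ℤ) ∣ (3 * k + 4) * 2 ^ j := ⟨_, hz⟩
      have hp3 : Prime (3 : ℤ) := Int.prime_three
      rcases hp3.dvd_or_dvd h3 with h | h
      · omega
      · have := hp3.dvd_of_dvd_pow h
        omega

theorem model_branching : Branching modelC modelLt := by
  classical
  intro a O G hOa hOG side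
  choose! lev hlev using fun (b : Finset ℚ) (hb : b ≠ a) => exists_splitAt hb
  have huniq : ∀ b r, SplitAt b a r → ∀ t, SplitAt b a t → r = t := by
    rintro b r ⟨h1, h2⟩ t ⟨h3, h4⟩
    rcases lt_trichotomy r t with h | h | h
    · exact absurd (h3 r h) h2
    · exact h
    · exact absurd (h1 t h) h4
  obtain ⟨p, hp1, hp2⟩ := Order.exists_between_finsets (O.image lev)
    ((G.filter (· ≠ a)).image lev) (by
      intro u hu v hv
      obtain ⟨b, hb, rfl⟩ := Finset.mem_image.1 hu
      obtain ⟨g, hg, rfl⟩ := Finset.mem_image.1 hv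
      obtain ⟨hg, hga⟩ := Finset.mem_filter.1 hg
      obtain ⟨r, hr, hr'⟩ := hOG b hb g hg
      rw [huniq b _ (hlev b (hOa b hb)) r hr]
      by_contra hc
      push Not at hc
      exact (hlev g hga).2 (hr' _ hc).symm)
  obtain ⟨q, hq1, hq2⟩ := Order.exists_between_finsets (insert p (a.filter (· ≤ p)))
    ((G.filter (· ≠ a)).image lev ∪ a.filter (p < ·)) (by
      intro u hu v hv
      have hu' : u ≤ p := by
        rcases Finset.mem_insert.1 hu with rfl | hu
        · exact le_rfl
        · exact (Finset.mem_filter.1 hu).2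
      have hv' : p < v := by
        rcases Finset.mem_union.1 hv with hv | hv
        · exact hp2 v hv
        · exact (Finset.mem_filter.1 hv).2
      exact lt_of_le_of_lt hu' hv')
  obtain ⟨s, hs1, hs2, hs3⟩ := exists_dyadic_iff (hq1 p (by simp)) side
  have hsa : s ∉ a := by
    intro hs
    have := hq2 s (Finset.mem_union_right _ (Finset.mem_filter.2 ⟨hs, hs1⟩))
    exact absurd this (not_lt.2 hs2.le)
  have hsplit : SplitAt (insert s a) a s := by
    refine ⟨?_, by simp [hsa]⟩
    intro t ht
    simp [ht.ne]
  refine ⟨insert s a, ?_, ?_, ?_, ?_⟩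
  · intro e
    rw [← e] at hsa
    simp at hsa
  · intro b hb
    refine ⟨lev b, hlev b (hOa b hb), fun t ht => (hsplit.1 t ?_).symm⟩
    exact lt_of_le_of_lt ht ((hp1 _ (Finset.mem_image_of_mem _ hb)).trans hs1)
  · intro g hg
    refine ⟨s, hsplit, fun t ht => ?_⟩
    by_cases hga : g = a
    · rw [hga]
    · have h1 := hq2 (lev g) (Finset.mem_union_left _ (Finset.mem_image_of_mem _
        (Finset.mem_filter.2 ⟨hg, hga⟩)))
      exact ((hlev g hga).1 t (lt_of_le_of_lt ht (hs2.trans h1))).symm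
  · constructor
    · rintro ⟨r, hr, hr'⟩
      rw [huniq _ r hr s hsplit] at hr'
      exact hs3.1 (hr'.1 (by simp))
    · intro hside
      exact ⟨s, hsplit, iff_of_true (by simp) (hs3.2 hside)⟩

end Model

end OrderedLeafModel

/-- The structure `(𝕃; C, ≺)` exists. -/
theorem exists_isOrderedLeafLimit :
    ∃ (C : Finset ℚ → Finset ℚ → Finset ℚ → Prop) (lt : Finset ℚ → Finset ℚ → Prop),
      IsOrderedLeafLimit C lt :=
  ⟨_, _, OrderedLeafModel.isOrderedLeafLimit_of_branching OrderedLeafModel.model_ordered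
    OrderedLeafModel.model_branching⟩

/-!
The proof replaces `e` by finitely many bits of information about types, and shows that every
combination of bits either makes all finite combs reachable, or is one of the two behaviors.

Reaching combs. `(L; C)` is homogeneous (`IsOrderedLeafLimit.homogeneousC_family`), so `lin` is
generated as soon as every finite set can be mapped, in increasing order, to a comb
(`GeneratesCombs.generatesLin`). The direction of the comb is irrelevant, since an automorphism of
`(L; C)` can reverse the order of a finite set (`GeneratesCombs.of_flip`). Hence `A` may be taken
to lie above `c`. To reach all combs it is enough to be able to move any one leaf of a finite tree
to the top without changing the rest of the tree (`generatesCombs_of_pull`).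

From `c`-universality to ordered patterns. Universality of `A` speaks about automorphisms of
`(L; C)`, which forget the order. By the order property (`IsOrderedLeafLimit.exists_forcing` and
`IsOrderedLeafLimit.exists_forcing_min`) the set `A` nevertheless contains a copy over `c` of every
finite ordered leaf structure with least element `c` (`IsUniversalAt.exists_isAutCLt`).

The analysis. By canonicity, all triples of a given type in `A ∪ {c}` have images of one of the
three possible shapes (`CanonicalAbove.three_options`). Inside a cone there are two types of triples
`x ≺ y ≺ z`. Patterns with four elements exclude all maps between shapes except the one that
preserves `C` and two that turn every finite set into a comb. For triples that involve two cones, or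
one cone and `c`, any shape other than the separating one makes `e` order a cone as a comb. So if
combs are not generated, `e` respects cones in the sense of `RespectsCones`. For two elements in
different cones, together with `c`, three shapes are left.
* `e` keeps the farther element on top: this is `id_c`.
* `e` puts the nearer element on top. Then `e` reverses the path from `c` to the root, and two
  applications of `e` move a leaf to the top (`RespectsCones.generatesCombs_of_reverse`).
* `e` puts `c` on top. Then triples in three different cones either keep their shape, in which case
  `e` moves `c` to the top (`RespectsCones.generatesCombs_of_lift`), or are reversed, which is
  `reroot_c`.
-/

open OrderedLeafModel

/-! ### Automorphisms, homogeneity of families, and branching -/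

theorem IsOrderedLeafStructure.comap {V W : Type*} {C : V → V → V → Prop} {lt : V → V → Prop}
    (h : IsOrderedLeafStructure C lt) {f : W → V} (hf : Function.Injective f) :
    IsOrderedLeafStructure (fun x y z => C (f x) (f y) (f z)) (fun x y => lt (f x) (f y)) where
  symm _ _ _ := h.symm _ _ _
  asymm _ _ _ := h.asymm _ _ _
  cut _ _ _ _ := h.cut _ _ _ _
  self _ _ n := h.self _ _ (hf.ne n)
  binary _ _ _ n₁ n₂ n₃ := h.binary _ _ _ (hf.ne n₁) (hf.ne n₂) (hf.ne n₃)
  irrefl _ := h.irrefl _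
  trans _ _ _ := h.trans _ _ _
  total _ _ n := h.total _ _ (hf.ne n)
  convex _ _ _ := h.convex _ _ _

/-- Reversing the order of an ordered leaf structure. -/
theorem IsOrderedLeafStructure.flip {V : Type*} {C : V → V → V → Prop} {lt : V → V → Prop}
    (h : IsOrderedLeafStructure C lt) : IsOrderedLeafStructure C (flip lt) where
  toIsBinaryCRelation := h.toIsBinaryCRelation
  irrefl := h.irrefl
  trans _ _ _ h₁ h₂ := h.trans _ _ _ h₂ h₁
  total _ _ n := (h.total _ _ n).symm
  convex x y z h₁ h₂ := by
    rcases h.convex z y x h₂ h₁ with h0 | h0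
    · exact Or.inr (h.symm _ _ _ h0)
    · exact Or.inl (h.symm _ _ _ h0)

section

variable {L : Type*} {C : L → L → L → Prop} {lt : L → L → Prop}

theorem IsAutC.trans {α β : Equiv.Perm L} (hα : IsAutC C α) (hβ : IsAutC C β) :
    IsAutC C (α.trans β) := fun x y z => (hβ _ _ _).trans (hα x y z)

theorem IsAutC.symm {α : Equiv.Perm L} (hα : IsAutC C α) : IsAutC C α.symm := fun x y z => by
  have := hα (α.symm x) (α.symm y) (α.symm z)
  simpa using this.symm

theorem IsAutCLt.trans {α β : Equiv.Perm L} (hα : IsAutCLt C lt α) (hβ : IsAutCLt C lt β) :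
    IsAutCLt C lt (α.trans β) := ⟨hα.1.trans hβ.1, fun x y => (hβ.2 _ _).trans (hα.2 x y)⟩

theorem IsAutCLt.symm {α : Equiv.Perm L} (hα : IsAutCLt C lt α) : IsAutCLt C lt α.symm :=
  ⟨hα.1.symm, fun x y => by
    have := hα.2 (α.symm x) (α.symm y)
    simpa using this.symm⟩

theorem IsBinaryCRelation.not_self (h : IsBinaryCRelation C) (x y : L) : ¬ C x x y :=
  fun hx => h.asymm _ _ _ hx hx

theorem IsBinaryCRelation.ne_left (h : IsBinaryCRelation C) {x y z : L} (hx : C x y z) :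
    x ≠ y := by
  rintro rfl
  exact h.not_self _ _ hx

theorem IsBinaryCRelation.ne_right (h : IsBinaryCRelation C) {x y z : L} (hx : C x y z) :
    x ≠ z := h.ne_left (h.symm _ _ _ hx)

/-- The elements that branch off from `x` together with `p` form a cone. -/
theorem IsBinaryCRelation.join (h : IsBinaryCRelation C) {x p y z : L} (hy : C x p y)
    (hz : C x p z) : C x y z := by
  rcases h.cut _ _ _ y hz with h1 | h1
  · exact h1
  rcases h.cut _ _ _ z hy with h2 | h2
  · exact h.symm _ _ _ h2
  · exact absurd (h.symm _ _ _ h1) (h.asymm _ _ _ (h.symm _ _ _ h2))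

/-- Homogeneity for indexed finite families. -/
theorem IsOrderedLeafLimit.homogeneous_family (hL : IsOrderedLeafLimit C lt) {ι : Type*} [Finite ι]
    (s t : ι → L) (hC : ∀ i j k, C (t i) (t j) (t k) ↔ C (s i) (s j) (s k))
    (hl : ∀ i j, lt (t i) (t j) ↔ lt (s i) (s j)) :
    ∃ α : Equiv.Perm L, IsAutCLt C lt α ∧ ∀ i, α (s i) = t i := by
  classical
  have := Fintype.ofFinite ι
  have hst : ∀ i j, s i = s j → t i = t j := by
    intro i j e
    by_contra hne
    rcases hL.total _ _ hne with h | h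
    · rw [hl, e] at h
      exact hL.irrefl _ h
    · rw [hl, e] at h
      exact hL.irrefl _ h
  let f : L → L := fun x => if h : ∃ i, s i = x then t h.choose else x
  have hf : ∀ i, f (s i) = t i := by
    intro i
    have h : ∃ j, s j = s i := ⟨i, rfl⟩
    simp only [f, dif_pos h]
    exact hst _ _ h.choose_spec
  obtain ⟨α, h1, h2⟩ := hL.homogeneous (Finset.univ.image s) f
    (by simpa [hf] using hC) (by simpa [hf] using hl)
  exact ⟨α, h1, fun i => by rw [h2 _ (by simp), hf]⟩

theorem IsOrderedLeafLimit.nonempty (hL : IsOrderedLeafLimit C lt) : Nonempty L := by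
  obtain ⟨f, -⟩ := hL.universal Unit (fun _ _ _ => False) (fun _ _ => False)
    ⟨⟨by simp, by simp, by simp, by simp, by simp⟩, by simp, by simp, by simp, by simp⟩
  exact ⟨f ()⟩

/-- The limit is branching: a finite subset together with a branching point is realised in the
concrete model, and brought back by universality and homogeneity. -/
theorem IsOrderedLeafLimit.branching (hL : IsOrderedLeafLimit C lt) : Branching C lt := by
  classical
  intro a O G hO hOG side
  let F : Finset L := insert a (O ∪ G)
  obtain ⟨f, hf1, hf2⟩ := exists_embedding
    (hL.toIsOrderedLeafStructure.comap (Subtype.val_injective (p := (· ∈ F)))) model_ordered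
    model_branching
  have hfi : Function.Injective f := by
    intro x y e
    by_contra hne
    rcases hL.total _ _ (Subtype.val_injective.ne hne) with h | h
    · rw [← hf2, e] at h
      exact model_ordered.irrefl _ h
    · rw [← hf2, e] at h
      exact model_ordered.irrefl _ h
  have ha : a ∈ F := by simp [F]
  have hOF : ∀ b ∈ O, b ∈ F := fun b hb => by simp [F, hb]
  have hGF : ∀ b ∈ G, b ∈ F := fun b hb => by simp [F, hb]
  obtain ⟨y, hy1, hy2, hy3, hy4⟩ := model_branching (f ⟨a, ha⟩)
    ((Finset.univ.filter fun x : F => x.1 ∈ O).image f)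
    ((Finset.univ.filter fun x : F => x.1 ∈ G).image f)
    (by
      intro b hb
      simp only [Finset.mem_image, Finset.mem_filter, Finset.mem_univ, true_and] at hb
      obtain ⟨x, hx, rfl⟩ := hb
      refine hfi.ne fun e => hO _ hx (congrArg Subtype.val e))
    (by
      intro b hb g hg
      simp only [Finset.mem_image, Finset.mem_filter, Finset.mem_univ, true_and] at hb hg
      obtain ⟨x, hx, rfl⟩ := hb
      obtain ⟨z, hz, rfl⟩ := hg
      rw [hf1]
      exact hOG _ hx _ hz) side
  let V' : Finset (Finset ℚ) := insert y (Finset.univ.image f)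
  obtain ⟨g, hg1, hg2⟩ := hL.universal V' _ _
    (model_ordered.comap (Subtype.val_injective (p := (· ∈ V'))))
  have hV : ∀ x : F, f x ∈ V' := fun x => by simp [V']
  have hyV : y ∈ V' := by simp [V']
  obtain ⟨α, hα, hαe⟩ := hL.homogeneous_family (fun x : F => x.1) (fun x => g ⟨f x, hV x⟩)
    (fun i j k => by rw [hg1, hf1]) (fun i j => by rw [hg2, hf2])
  refine ⟨α.symm (g ⟨y, hyV⟩), ?_, ?_, ?_, ?_⟩
  · intro e
    have e1 : α a = g ⟨y, hyV⟩ := by rw [← e]; simp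
    rw [hαe ⟨a, ha⟩] at e1
    rcases model_ordered.total _ _ hy1 with h | h
    · have h' := (hg2 ⟨y, hyV⟩ ⟨_, hV ⟨a, ha⟩⟩).2 h
      rw [e1] at h'
      exact hL.irrefl _ h'
    · have h' := (hg2 ⟨_, hV ⟨a, ha⟩⟩ ⟨y, hyV⟩).2 h
      rw [e1] at h'
      exact hL.irrefl _ h'
  · intro b hb
    rw [← hα.1]
    rw [hαe ⟨b, hOF b hb⟩, hαe ⟨a, ha⟩, Equiv.apply_symm_apply, hg1]
    exact hy2 _ (Finset.mem_image_of_mem _ (by simpa using hb))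
  · intro b hb
    rw [← hα.1]
    rw [hαe ⟨b, hGF b hb⟩, hαe ⟨a, ha⟩, Equiv.apply_symm_apply, hg1]
    exact hy3 _ (Finset.mem_image_of_mem _ (by simpa using hb))
  · rw [← hα.2, hαe ⟨a, ha⟩, Equiv.apply_symm_apply, hg2]
    exact hy4

/-- Reversing the order of the limit structure. -/
theorem IsOrderedLeafLimit.flip (hL : IsOrderedLeafLimit C lt) :
    IsOrderedLeafLimit C (flip lt) where
  toIsOrderedLeafStructure := hL.toIsOrderedLeafStructure.flip
  countable := hL.countable
  universal V _ C' lt' h := by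
    obtain ⟨f, h1, h2⟩ := hL.universal V C' (_root_.flip lt') h.flip
    exact ⟨f, h1, fun x y => h2 y x⟩
  homogeneous F f h1 h2 := by
    obtain ⟨α, h3, h4⟩ := hL.homogeneous F f h1 fun x hx y hy => h2 y hy x hx
    exact ⟨α, ⟨h3.1, fun x y => h3.2 y x⟩, h4⟩

theorem isAutCLt_flip {α : Equiv.Perm L} :
    IsAutCLt C (flip lt) α ↔ IsAutCLt C lt α :=
  ⟨fun h => ⟨h.1, fun x y => h.2 y x⟩, fun h => ⟨h.1, fun x y => h.2 y x⟩⟩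

/-! ### Homogeneity of the C-relation without the order -/

/-- Finite partial isomorphisms of `(L; C)`, as sets of pairs. -/
def IsPartialIsoC (C : L → L → L → Prop) (S : Finset (L × L)) : Prop :=
  ∀ p ∈ S, ∀ q ∈ S, ∀ r ∈ S, C p.1 q.1 r.1 ↔ C p.2 q.2 r.2

theorem IsPartialIsoC.swap [DecidableEq L] {S : Finset (L × L)} (hS : IsPartialIsoC C S) :
    IsPartialIsoC C (S.image Prod.swap) := by
  intro p hp q hq r hr
  simp only [Finset.mem_image, Prod.exists, Prod.swap_prod_mk] at hp hq hr
  obtain ⟨a, b, hp, rfl⟩ := hp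
  obtain ⟨a', b', hq, rfl⟩ := hq
  obtain ⟨a'', b'', hr, rfl⟩ := hr
  exact (hS _ hp _ hq _ hr).symm

/-- The order plays no role in this one-point extension; of `Branching` only the C-part is used. -/
theorem IsPartialIsoC.extend [DecidableEq L] [Nonempty L] (h : IsBinaryCRelation C)
    (hbr : Branching C lt) {S : Finset (L × L)} (hS : IsPartialIsoC C S) (x : L) :
    ∃ y, IsPartialIsoC C (insert (x, y) S) := by
  classical
  by_cases hx : ∃ p ∈ S, p.1 = x
  · obtain ⟨p, hp, rfl⟩ := hx
    exact ⟨p.2, by simpa [Finset.insert_eq_of_mem hp] using hS⟩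
  push Not at hx
  have hC0 := h.not_self
  have hC1 : ∀ z w, ¬ C z w z := fun z w hz => hC0 _ _ (h.symm _ _ _ hz)
  rcases S.eq_empty_or_nonempty with rfl | hne
  · refine ⟨Classical.arbitrary L, ?_⟩
    simp [IsPartialIsoC, hC0]
  obtain ⟨a0, ha0, hclosest⟩ := exists_closest h x (hne.image Prod.fst)
  obtain ⟨a, ha, rfl⟩ := Finset.mem_image.1 ha0
  have hGO : ∀ p ∈ S, C x a.1 p.1 ∨ C p.1 a.1 x := by
    intro p hp
    have e1 := hclosest _ (Finset.mem_image_of_mem _ hp)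
    have e2 := hx p hp
    have e3 := hx a ha
    have h1 := h.symm
    have h4 := h.self
    have h5 := h.binary
    grind
  obtain ⟨y, hya, hyO, hyG, -⟩ := hbr a.2 ((S.filter fun p => ¬ C x a.1 p.1).image Prod.snd)
    ((S.filter fun p => C x a.1 p.1).image Prod.snd)
    (by
      intro b hb hba
      obtain ⟨p, hp, rfl⟩ := Finset.mem_image.1 hb
      obtain ⟨hp, hpx⟩ := Finset.mem_filter.1 hp
      have h0 : C p.1 a.1 a.1 := by
        rcases hGO p hp with h0 | h0
        · exact absurd h0 hpx
        · exact h.self _ _ (h.ne_left h0)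
      have := (hS p hp a ha a ha).1 h0
      rw [hba] at this
      exact hC0 _ _ this)
    (by
      intro b hb g hg
      obtain ⟨p, hp, rfl⟩ := Finset.mem_image.1 hb
      obtain ⟨hp, hpx⟩ := Finset.mem_filter.1 hp
      obtain ⟨q, hq, rfl⟩ := Finset.mem_image.1 hg
      obtain ⟨hq, hqx⟩ := Finset.mem_filter.1 hq
      rw [← hS p hp a ha q hq]
      obtain ⟨h1, h2, h3, h4, h5⟩ := h
      have := hGO p hp
      grind) True
  have hO : ∀ p ∈ S, ¬ C x a.1 p.1 → C p.2 a.2 y := fun p hp hpx =>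
    hyO _ (Finset.mem_image_of_mem _ (Finset.mem_filter.2 ⟨hp, hpx⟩))
  have hG : ∀ p ∈ S, C x a.1 p.1 → C y a.2 p.2 := fun p hp hpx =>
    hyG _ (Finset.mem_image_of_mem _ (Finset.mem_filter.2 ⟨hp, hpx⟩))
  have hGO' : ∀ p ∈ S, C y a.2 p.2 ∨ C p.2 a.2 y := by
    intro p hp
    by_cases hpx : C x a.1 p.1
    · exact Or.inl (hG p hp hpx)
    · exact Or.inr (hO p hp hpx)
  have hiff : ∀ p ∈ S, (C x a.1 p.1 ↔ C y a.2 p.2) := by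
    intro p hp
    refine ⟨hG p hp, fun h0 => ?_⟩
    by_contra hpx
    have h1 := hO p hp hpx
    exact h.asymm _ _ _ (h.symm _ _ _ h1) (h.symm _ _ _ h0)
  have hyne : ∀ p ∈ S, p.2 ≠ y := by
    rintro p hp rfl
    rcases hGO' p hp with h0 | h0
    · exact hC1 _ _ h0
    · exact hC1 _ _ h0
  have k1 : ∀ p ∈ S, ∀ q ∈ S, (C x p.1 q.1 ↔ C y p.2 q.2) := by
    intro p hp q hq
    rw [rel_xbb h (hGO p hp) (hGO q hq), rel_xbb h (hGO' p hp) (hGO' q hq), hiff p hp, hiff q hq,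
      hS a ha p hp q hq]
  have k2 : ∀ p ∈ S, ∀ q ∈ S, (C p.1 x q.1 ↔ C p.2 y q.2) := by
    intro p hp q hq
    rw [rel_bxb h (hGO p hp) (hGO q hq), rel_bxb h (hGO' p hp) (hGO' q hq), hiff p hp, hiff q hq,
      hS p hp a ha q hq]
  have k3 : ∀ p ∈ S, ∀ q ∈ S, (C p.1 q.1 x ↔ C p.2 q.2 y) := by
    intro p hp q hq
    have e1 : C p.1 q.1 x ↔ C p.1 x q.1 := ⟨h.symm _ _ _, h.symm _ _ _⟩
    have e2 : C p.2 q.2 y ↔ C p.2 y q.2 := ⟨h.symm _ _ _, h.symm _ _ _⟩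
    rw [e1, e2, k2 p hp q hq]
  refine ⟨y, ?_⟩
  intro p hp q hq r hr
  rcases Finset.mem_insert.1 hp with rfl | hp <;> rcases Finset.mem_insert.1 hq with rfl | hq <;>
    rcases Finset.mem_insert.1 hr with rfl | hr
  · simp [hC0]
  · simp [hC0]
  · simp [hC1]
  · exact k1 q hq r hr
  · exact iff_of_true (h.self _ _ (hx p hp)) (h.self _ _ (hyne p hp))
  · exact k2 p hp r hr
  · exact k3 p hp q hq
  · exact hS p hp q hq r hr

/-- `(L; C)` is homogeneous, by a back-and-forth argument. -/
theorem IsOrderedLeafLimit.homogeneousC_family (hL : IsOrderedLeafLimit C lt) {ι : Type*}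
    [Finite ι] (s t : ι → L) (hst : ∀ i j k, C (t i) (t j) (t k) ↔ C (s i) (s j) (s k)) :
    ∃ α : Equiv.Perm L, IsAutC C α ∧ ∀ i, α (s i) = t i := by
  classical
  have h : IsBinaryCRelation C := hL.toIsBinaryCRelation
  have hbr := hL.branching
  have := hL.nonempty
  have := hL.countable
  have := Fintype.ofFinite ι
  obtain ⟨en, hen⟩ := exists_surjective_nat L
  have step : ∀ (T : {T : Finset (L × L) // IsPartialIsoC C T}) (x : L),
      ∃ T' : {T : Finset (L × L) // IsPartialIsoC C T},
        T.1 ⊆ T'.1 ∧ (∃ y, (x, y) ∈ T'.1) ∧ ∃ y, (y, x) ∈ T'.1 := by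
    rintro ⟨T, hT⟩ x
    obtain ⟨y, hy⟩ := hT.extend h hbr x
    obtain ⟨z, hz⟩ := hy.swap.extend h hbr x
    have hz' := hz.swap
    rw [Finset.image_insert, Finset.image_image, Prod.swap_swap_eq, Finset.image_id] at hz'
    refine ⟨⟨_, hz'⟩, ?_, ⟨y, by simp⟩, ⟨z, by simp⟩⟩
    intro p hp
    simp [hp]
  choose nxt n1 n2 n3 using step
  have hS : IsPartialIsoC C (Finset.univ.image fun i => (s i, t i)) := by
    intro p hp q hq r hr
    simp only [Finset.mem_image, Finset.mem_univ, true_and] at hp hq hr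
    obtain ⟨i, rfl⟩ := hp
    obtain ⟨j, rfl⟩ := hq
    obtain ⟨k, rfl⟩ := hr
    exact (hst i j k).symm
  let chain : ℕ → {T : Finset (L × L) // IsPartialIsoC C T} :=
    fun n => Nat.rec ⟨_, hS⟩ (fun k T => nxt T (en k)) n
  have hmono : Monotone fun n => (chain n).1 := monotone_nat_of_le_succ fun n => n1 _ _
  have hcommon : ∀ p q r : L × L, (∃ n, p ∈ (chain n).1) → (∃ n, q ∈ (chain n).1) →
      (∃ n, r ∈ (chain n).1) → (C p.1 q.1 r.1 ↔ C p.2 q.2 r.2) := by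
    rintro p q r ⟨i, hi⟩ ⟨j, hj⟩ ⟨k, hk⟩
    have e1 := hmono (le_max_left i (max j k)) hi
    have e2 := hmono ((le_max_left j k).trans (le_max_right i (max j k))) hj
    have e3 := hmono ((le_max_right j k).trans (le_max_right i (max j k))) hk
    exact (chain (max i (max j k))).2 _ e1 _ e2 _ e3
  have hdom : ∀ x, ∃ y, ∃ n, (x, y) ∈ (chain n).1 := by
    intro x
    obtain ⟨k, rfl⟩ := hen x
    obtain ⟨y, hy⟩ := n2 (chain k) (en k)
    exact ⟨y, k + 1, hy⟩
  have hran : ∀ y, ∃ x, ∃ n, (x, y) ∈ (chain n).1 := by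
    intro y
    obtain ⟨k, rfl⟩ := hen y
    obtain ⟨x, hx⟩ := n3 (chain k) (en k)
    exact ⟨x, k + 1, hx⟩
  have heq : ∀ p q : L × L, (∃ n, p ∈ (chain n).1) → (∃ n, q ∈ (chain n).1) →
      (p.1 = q.1 ↔ p.2 = q.2) := by
    intro p q hp hq
    have e1 := hcommon p q q hp hq hq
    constructor
    · intro e
      by_contra hne
      exact h.not_self _ _ (e ▸ e1.2 (h.self _ _ hne))
    · intro e
      by_contra hne
      exact h.not_self _ _ (e ▸ e1.1 (h.self _ _ hne))
  choose f hf using hdom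
  choose g hg using hran
  refine ⟨⟨f, g, fun x => (heq _ _ (hg (f x)) (hf x)).2 rfl,
    fun y => (heq _ _ (hf (g y)) (hg y)).1 rfl⟩, ?_, ?_⟩
  · exact fun x y z => (hcommon _ _ _ (hf x) (hf y) (hf z)).symm
  · exact fun i => (heq (_, _) (s i, t i) (hf (s i))
      ⟨0, Finset.mem_image_of_mem (fun i => (s i, t i)) (Finset.mem_univ i)⟩).1 rfl

end

/-! ### Separated unions, and the order property -/

/-- The C-relation of the tree with root subtrees `V` and `W`. -/
def sumRel {V W : Type*} (C : V → V → V → Prop) (C' : W → W → W → Prop) :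
    V ⊕ W → V ⊕ W → V ⊕ W → Prop
  | .inl x, .inl y, .inl z => C x y z
  | .inr x, .inr y, .inr z => C' x y z
  | .inl _, .inr _, .inr _ => True
  | .inr _, .inl _, .inl _ => True
  | _, _, _ => False

theorem IsOrderedLeafStructure.sum {V W : Type*} {C : V → V → V → Prop} {lt : V → V → Prop}
    {C' : W → W → W → Prop} {lt' : W → W → Prop} (h : IsOrderedLeafStructure C lt)
    (h' : IsOrderedLeafStructure C' lt') :
    IsOrderedLeafStructure (sumRel C C') (Sum.Lex lt lt') := by
  obtain ⟨⟨a1, a2, a3, a4, a5⟩, a6, a7, a8, a9⟩ := h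
  obtain ⟨⟨b1, b2, b3, b4, b5⟩, b6, b7, b8, b9⟩ := h'
  refine ⟨⟨?_, ?_, ?_, ?_, ?_⟩, ?_, ?_, ?_, ?_⟩
  · rintro (x | x) (y | y) (z | z) <;> simp only [sumRel] <;> grind
  · rintro (x | x) (y | y) (z | z) <;> simp only [sumRel] <;> grind
  · rintro (x | x) (y | y) (z | z) (w | w) <;> simp only [sumRel] <;> grind
  · rintro (x | x) (y | y) <;> simp only [sumRel] <;> grind
  · rintro (x | x) (y | y) (z | z) <;> simp only [sumRel, ne_eq, Sum.inl.injEq, Sum.inr.injEq] <;>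
      grind
  · rintro (x | x) <;> simp [a6, b6]
  · rintro (x | x) (y | y) (z | z) <;> simp <;> grind
  · rintro (x | x) (y | y) <;> simp <;> grind
  · rintro (x | x) (y | y) (z | z) <;> simp [sumRel] <;> grind

section

variable {L : Type*} {C : L → L → L → Prop} {lt : L → L → Prop}

/-- Any finite set has a copy that forms, together with another given finite set, the two subtrees
of a common root. -/
theorem IsOrderedLeafLimit.exists_setSep (hL : IsOrderedLeafLimit C lt) (U₁ U₂ : Finset L) :
    ∃ γ : Equiv.Perm L, IsAutCLt C lt γ ∧ SetSep C U₁ (γ '' U₂) ∧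
      ∀ x ∈ U₁, ∀ y ∈ U₂, lt x (γ y) := by
  classical
  have := hL.nonempty
  obtain ⟨f, hf1, hf2⟩ := exists_embedding
    ((hL.toIsOrderedLeafStructure.comap (Subtype.val_injective (p := (· ∈ U₁)))).sum
      (hL.toIsOrderedLeafStructure.comap (Subtype.val_injective (p := (· ∈ U₂)))))
    hL.toIsOrderedLeafStructure hL.branching
  obtain ⟨δ₁, h1, h1'⟩ := hL.homogeneous_family (fun x : U₁ => x.1) (fun x => f (.inl x))
    (fun i j k => hf1 _ _ _) (fun i j => by rw [hf2]; simp)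
  obtain ⟨δ₂, h2, h2'⟩ := hL.homogeneous_family (fun x : U₂ => x.1) (fun x => f (.inr x))
    (fun i j k => hf1 _ _ _) (fun i j => by rw [hf2]; simp)
  refine ⟨δ₂.trans δ₁.symm, h2.trans h1.symm, ⟨?_, ?_⟩, ?_⟩
  · rintro x hx x' hx' _ ⟨y, hy, rfl⟩
    rw [← h1.1, h1' ⟨x, hx⟩, h1' ⟨x', hx'⟩]
    simp only [Equiv.trans_apply, Equiv.apply_symm_apply]
    rw [h2' ⟨y, hy⟩, hf1]
    trivial
  · rintro x hx _ ⟨y, hy, rfl⟩ _ ⟨y', hy', rfl⟩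
    rw [← h1.1, h1' ⟨x, hx⟩]
    simp only [Equiv.trans_apply, Equiv.apply_symm_apply]
    rw [h2' ⟨y, hy⟩, h2' ⟨y', hy'⟩, hf1]
    trivial
  · intro x hx y hy
    rw [← h1.2, h1' ⟨x, hx⟩]
    simp only [Equiv.trans_apply, Equiv.apply_symm_apply]
    rw [h2' ⟨y, hy⟩, hf2]
    simp

/-- Isomorphic copies of two sets can be glued across a root. -/
theorem IsOrderedLeafLimit.glue (hL : IsOrderedLeafLimit C lt) {T₁ T₂ : Finset L} {X₁ X₂ : Set L}
    (hT : SetSep C T₁ T₂) (hTl : ∀ x ∈ T₁, ∀ y ∈ T₂, lt x y)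
    (hX : SetSep C X₁ X₂) (hXl : ∀ x ∈ X₁, ∀ y ∈ X₂, lt x y) {β₁ β₂ : Equiv.Perm L}
    (h₁ : IsAutCLt C lt β₁) (h₂ : IsAutCLt C lt β₂) (hm₁ : ∀ x ∈ T₁, β₁ x ∈ X₁)
    (hm₂ : ∀ x ∈ T₂, β₂ x ∈ X₂) :
    ∃ β : Equiv.Perm L, IsAutCLt C lt β ∧ (∀ x ∈ T₁, β x = β₁ x) ∧ ∀ x ∈ T₂, β x = β₂ x := by
  obtain ⟨t1, t2⟩ := hT
  obtain ⟨s1, s2⟩ := hX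
  have a1 := hL.symm
  have a2 := hL.asymm
  have a3 := hL.irrefl
  have a4 := hL.trans
  obtain ⟨β, h, hβ⟩ := hL.homogeneous_family (ι := T₁ ⊕ T₂)
    (Sum.elim (fun x => x.1) (fun x => x.1)) (Sum.elim (fun x => β₁ x.1) (fun x => β₂ x.1))
    (by
      rintro (⟨x, hx⟩ | ⟨x, hx⟩) (⟨y, hy⟩ | ⟨y, hy⟩) (⟨z, hz⟩ | ⟨z, hz⟩) <;>
        simp only [Sum.elim_inl, Sum.elim_inr]
      · exact h₁.1 _ _ _
      · grind
      · grind
      · grind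
      · grind
      · grind
      · grind
      · exact h₂.1 _ _ _)
    (by
      rintro (⟨x, hx⟩ | ⟨x, hx⟩) (⟨y, hy⟩ | ⟨y, hy⟩) <;> simp only [Sum.elim_inl, Sum.elim_inr]
      · exact h₁.2 _ _
      · grind
      · grind
      · exact h₂.2 _ _)
  exact ⟨β, h, fun x hx => hβ (.inl ⟨x, hx⟩), fun x hx => hβ (.inr ⟨x, hx⟩)⟩

theorem IsOrderedLeafStructure.exists_min (h : IsOrderedLeafStructure C lt) {T : Finset L}
    (hT : T.Nonempty) : ∃ m ∈ T, ∀ x ∈ T, x = m ∨ lt m x := by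
  have h1 := h.trans
  have h2 := h.total
  induction hT using Finset.Nonempty.cons_induction with
  | singleton a => exact ⟨a, by simp⟩
  | cons a s ha hs ih =>
    obtain ⟨m, hm, hx⟩ := ih
    by_cases ham : lt a m
    · refine ⟨a, by simp, ?_⟩
      intro x hxs
      rcases Finset.mem_cons.1 hxs with rfl | hxs
      · exact Or.inl rfl
      · grind
    · refine ⟨m, by simp [hm], ?_⟩
      intro x hxs
      rcases Finset.mem_cons.1 hxs with rfl | hxs
      · grind
      · exact hx x hxs

/-- Separated sets are ordered one before the other. -/
theorem SetSep.lt_of_lt (h : IsOrderedLeafStructure C lt) {X Y : Set L} (hs : SetSep C X Y)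
    {x₀ y₀ : L} (hx₀ : x₀ ∈ X) (hy₀ : y₀ ∈ Y) (hlt : lt x₀ y₀) : ∀ x ∈ X, ∀ y ∈ Y, lt x y := by
  intro x hx y hy
  exact (lt_iff_of_near h (hs.1 x₀ hx₀ x hx y hy)).2.2
    ((lt_iff_of_near h (hs.2 x₀ hx₀ y₀ hy₀ y hy)).1.2 hlt)

/-- A finite set with at least two elements is split by its root into a left and a right part. -/
theorem IsOrderedLeafStructure.exists_root_split (h : IsOrderedLeafStructure C lt) {T : Finset L}
    {m : L} (hm : m ∈ T) (hmin : ∀ x ∈ T, x = m ∨ lt m x) (hT : T ≠ {m}) :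
    ∃ T₁ T₂ : Finset L, T₁ ⊂ T ∧ T₂ ⊂ T ∧ m ∈ T₁ ∧ (∀ x ∈ T, x ∈ T₁ ∨ x ∈ T₂) ∧
      SetSep C T₁ T₂ ∧ ∀ x ∈ T₁, ∀ y ∈ T₂, lt x y := by
  classical
  -- the root is the branching point of the least and the greatest element
  obtain ⟨M, hM, hmax⟩ := h.flip.exists_min ⟨m, hm⟩
  change ∀ x ∈ T, x = M ∨ lt x M at hmax
  have h' := h
  obtain ⟨⟨a1, a2, a3, a4, a5⟩, a6, a7, a8, a9⟩ := h
  have hmM : m ≠ M := by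
    rintro rfl
    apply hT
    ext x
    simp only [Finset.mem_singleton]
    constructor
    · grind
    · rintro rfl
      exact hm
  have hlt : lt m M := by grind
  have hcover : ∀ x ∈ T, C M m x ∨ C m M x := by
    intro x hx
    have e1 := hmin x hx
    have e2 := hmax x hx
    have e3 := a9 m x M
    have e4 := a4 m M hmM
    have e5 := a4 M m hmM.symm
    grind
  have hsep : SetSep C {x | C M m x} {y | C m M y} := by
    simp only [SetSep, Set.mem_ofPred_eq]
    constructor
    · intro x hx x' hx' y hy
      grind
    · intro x hx y hy y' hy'
      grind
  refine ⟨T.filter fun x => C M m x, T.filter fun x => C m M x, ?_, ?_, ?_, ?_, ?_, ?_⟩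
  · refine (Finset.filter_ssubset).2 ⟨M, hM, ?_⟩
    grind
  · refine (Finset.filter_ssubset).2 ⟨m, hm, ?_⟩
    grind
  · simp [hm, a4 M m hmM.symm]
  · intro x hx
    simpa [hx] using hcover x hx
  · simp only [SetSep, Finset.coe_filter, Set.mem_ofPred_eq]
    exact ⟨fun x hx x' hx' y hy => hsep.1 x hx.2 x' hx'.2 y hy.2,
      fun x hx y hy y' hy' => hsep.2 x hx.2 y hy.2 y' hy'.2⟩
  · intro x hx y hy
    exact hsep.lt_of_lt h' (a4 M m hmM.symm) (a4 m M hmM) hlt x (Finset.mem_filter.1 hx).2 y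
      (Finset.mem_filter.1 hy).2

theorem IsAutC.setSep_image {α : Equiv.Perm L} (hα : IsAutC C α) {X Y : Set L}
    (h : SetSep C X Y) : SetSep C (α '' X) (α '' Y) := by
  constructor
  · rintro _ ⟨x, hx, rfl⟩ _ ⟨x', hx', rfl⟩ _ ⟨y, hy, rfl⟩
    exact (hα _ _ _).2 (h.1 x hx x' hx' y hy)
  · rintro _ ⟨x, hx, rfl⟩ _ ⟨y, hy, rfl⟩ _ ⟨y', hy', rfl⟩
    exact (hα _ _ _).2 (h.2 x hx y hy y' hy')

theorem SetSep.symm {X Y : Set L} (hs : SetSep C X Y) : SetSep C Y X :=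
  ⟨fun y hy y' hy' x hx => hs.2 x hx y hy y' hy', fun y hy x hx x' hx' => hs.1 x hx x' hx' y hy⟩

/-- The order property: for every finite `T` there is a finite `U` such that every copy of `U` with
respect to `C` alone contains a copy of `T` with respect to `C` and `≺`. If `T` splits into
`T₁ ≺ T₂` at its root, one takes for `U` a set with two root subtrees, each of which forces both
`T₁` and `T₂`. -/
theorem IsOrderedLeafLimit.exists_forcing (hL : IsOrderedLeafLimit C lt) (T : Finset L) :
    ∃ U : Finset L, ∀ α, IsAutC C α →
      ∃ β, IsAutCLt C lt β ∧ ∀ x ∈ T, β x ∈ α '' (U : Set L) := by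
  classical
  induction T using Finset.strongInduction with
  | H T ih =>
  rcases T.eq_empty_or_nonempty with rfl | hne
  · exact ⟨∅, fun α _ => ⟨Equiv.refl L, ⟨fun _ _ _ => Iff.rfl, fun _ _ => Iff.rfl⟩, by simp⟩⟩
  obtain ⟨m, hm, hmin⟩ := hL.exists_min hne
  by_cases hT : T = {m}
  · subst hT
    refine ⟨{m}, fun α _ => ?_⟩
    obtain ⟨β, hβ, e⟩ := hL.homogeneous_family (fun _ : Unit => m) (fun _ => α m)
      (by simp [hL.not_self]) (by simp [hL.irrefl])
    exact ⟨β, hβ, by simpa using e ()⟩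
  obtain ⟨T₁, T₂, hs₁, hs₂, -, hT12, hsep, hlt⟩ := hL.exists_root_split hm hmin hT
  obtain ⟨U₁, hU₁⟩ := ih T₁ hs₁
  obtain ⟨U₂, hU₂⟩ := ih T₂ hs₂
  obtain ⟨γ, hγ, hγs, -⟩ := hL.exists_setSep (U₁ ∪ U₂) (U₁ ∪ U₂)
  rcases (U₁ ∪ U₂).eq_empty_or_nonempty with h0 | ⟨p, hp⟩
  · refine ⟨∅, fun α hα => ?_⟩
    simp only [Finset.union_eq_empty] at h0
    obtain ⟨β₁, -, h1⟩ := hU₁ α hα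
    obtain ⟨β₂, -, h2⟩ := hU₂ α hα
    simp only [h0.1, h0.2, Finset.coe_empty, Set.image_empty, Set.mem_empty_iff_false] at h1 h2
    rcases hT12 m hm with h | h
    · exact (h1 m h).elim
    · exact (h2 m h).elim
  have main : ∀ (X₁ X₂ : Set L), SetSep C X₁ X₂ → (∀ x ∈ X₁, ∀ y ∈ X₂, lt x y) →
      (∃ β, IsAutCLt C lt β ∧ ∀ x ∈ T₁, β x ∈ X₁) → (∃ β, IsAutCLt C lt β ∧ ∀ x ∈ T₂, β x ∈ X₂) →
      ∃ β, IsAutCLt C lt β ∧ ∀ x ∈ T, β x ∈ X₁ ∪ X₂ := by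
    rintro X₁ X₂ hX hXl ⟨β₁, h₁, h₁'⟩ ⟨β₂, h₂, h₂'⟩
    obtain ⟨β, hβ, e1, e2⟩ := hL.glue hsep hlt hX hXl h₁ h₂ h₁' h₂'
    refine ⟨β, hβ, fun x hx => ?_⟩
    rcases hT12 x hx with h | h
    · rw [e1 x h]
      exact Or.inl (h₁' x h)
    · rw [e2 x h]
      exact Or.inr (h₂' x h)
  have force : ∀ α, IsAutC C α →
      (∃ β, IsAutCLt C lt β ∧ ∀ x ∈ T₁, β x ∈ α '' (↑(U₁ ∪ U₂) : Set L)) ∧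
      (∃ β, IsAutCLt C lt β ∧ ∀ x ∈ T₂, β x ∈ α '' (↑(U₁ ∪ U₂) : Set L)) := by
    intro α hα
    obtain ⟨β₁, h₁, h₁'⟩ := hU₁ α hα
    obtain ⟨β₂, h₂, h₂'⟩ := hU₂ α hα
    exact ⟨⟨β₁, h₁, fun x hx => Set.image_mono (by simp) (h₁' x hx)⟩,
      ⟨β₂, h₂, fun x hx => Set.image_mono (by simp) (h₂' x hx)⟩⟩
  refine ⟨(U₁ ∪ U₂) ∪ (U₁ ∪ U₂).image γ, fun α hα => ?_⟩
  have hsα := hα.setSep_image hγs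
  have f1 := force α hα
  have f2 := force (γ.trans α) (hγ.1.trans hα)
  have him : α '' (γ '' (↑(U₁ ∪ U₂) : Set L)) = (γ.trans α) '' (↑(U₁ ∪ U₂) : Set L) := by
    rw [Set.image_image]
    rfl
  rw [him] at hsα
  have hU : α '' (↑((U₁ ∪ U₂) ∪ (U₁ ∪ U₂).image γ) : Set L) =
      α '' (↑(U₁ ∪ U₂) : Set L) ∪ (γ.trans α) '' (↑(U₁ ∪ U₂) : Set L) := by
    rw [Finset.coe_union, Set.image_union, Finset.coe_image, him]
  rw [hU]
  have m1 : α p ∈ α '' (↑(U₁ ∪ U₂) : Set L) := Set.mem_image_of_mem _ hp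
  have m2 : (γ.trans α) p ∈ (γ.trans α) '' (↑(U₁ ∪ U₂) : Set L) := Set.mem_image_of_mem _ hp
  rcases hL.total (α p) ((γ.trans α) p) (by
    intro e
    exact hL.not_self _ _ (e ▸ hsα.1 _ m1 _ m1 _ m2)) with h | h
  · exact main _ _ hsα (hsα.lt_of_lt hL.toIsOrderedLeafStructure m1 m2 h) f1.1 f2.2
  · rw [Set.union_comm]
    have hsα' := hsα.symm
    exact main _ _ hsα' (hsα'.lt_of_lt hL.toIsOrderedLeafStructure m2 m1 h) f2.1 f1.2

/-- The order property over a least element: if a copy of `U` with respect to `C` alone has the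
image of `u` as its least element, then it contains an ordered copy of `T` with least element the
image of `u`. -/
theorem IsOrderedLeafLimit.exists_forcing_min (hL : IsOrderedLeafLimit C lt) (T : Finset L) {u : L}
    (hu : u ∈ T) (hmin : ∀ x ∈ T, x = u ∨ lt u x) :
    ∃ U : Finset L, u ∈ U ∧ ∀ α, IsAutC C α → (∀ x ∈ U, x = u ∨ lt (α u) (α x)) →
      ∃ β, IsAutCLt C lt β ∧ β u = α u ∧ ∀ x ∈ T, β x ∈ α '' (U : Set L) := by
  classical
  induction T using Finset.strongInduction with
  | H T ih =>
  by_cases hT : T = {u}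
  · subst hT
    refine ⟨{u}, by simp, fun α _ _ => ?_⟩
    obtain ⟨β, hβ, e⟩ := hL.homogeneous_family (fun _ : Unit => u) (fun _ => α u)
      (by simp [hL.not_self]) (by simp [hL.irrefl])
    exact ⟨β, hβ, e (), by simpa using e ()⟩
  obtain ⟨T₁, T₂, hs₁, hs₂, hu₁, hT12, hsep, hlt⟩ := hL.exists_root_split hu hmin hT
  obtain ⟨U₁, huU, hU₁⟩ := ih T₁ hs₁ hu₁ fun x hx => hmin x (hs₁.1 hx)
  obtain ⟨U₂, hU₂⟩ := hL.exists_forcing T₂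
  obtain ⟨γ, hγ, hγs, hγl⟩ := hL.exists_setSep U₁ U₂
  refine ⟨U₁ ∪ U₂.image γ, by simp [huU], fun α hα hαm => ?_⟩
  have hsα := hα.setSep_image hγs
  obtain ⟨β₁, h₁, h₁u, h₁'⟩ := hU₁ α hα fun x hx => hαm x (by simp [hx])
  obtain ⟨β₂, h₂, h₂'⟩ := hU₂ (γ.trans α) (hγ.1.trans hα)
  have him : α '' (γ '' (U₂ : Set L)) = (γ.trans α) '' (U₂ : Set L) := by
    rw [Set.image_image]
    rfl
  rw [him] at hsα
  have hll : ∀ x ∈ α '' (U₁ : Set L), ∀ y ∈ (γ.trans α) '' (U₂ : Set L), lt x y := by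
    rintro x hx _ ⟨y, hy, rfl⟩
    refine hsα.lt_of_lt hL.toIsOrderedLeafStructure (Set.mem_image_of_mem _ huU)
      (Set.mem_image_of_mem _ hy) ?_ x hx _ (Set.mem_image_of_mem _ hy)
    refine (hαm (γ y) (Finset.mem_union_right _ (Finset.mem_image_of_mem _ hy))).resolve_left ?_
    intro e
    have := hγl u huU y hy
    rw [e] at this
    exact hL.irrefl _ this
  obtain ⟨β, hβ, e1, e2⟩ := hL.glue hsep hlt hsα hll h₁ h₂ h₁' h₂'
  refine ⟨β, hβ, by rw [e1 u hu₁, h₁u], fun x hx => ?_⟩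
  rw [Finset.coe_union, Set.image_union, Finset.coe_image, him]
  rcases hT12 x hx with h | h
  · rw [e1 x h]
    exact Or.inl (h₁' x h)
  · rw [e2 x h]
    exact Or.inr (h₂' x h)

/-- A `c`-universal set above `c` is universal for ordered structures with least element `c`. -/
theorem IsUniversalAt.exists_isAutCLt (hL : IsOrderedLeafLimit C lt) {c : L} {A : Set L}
    (hA : IsUniversalAt C c A) (hside : ∀ x ∈ A, lt c x) (T : Finset L) {u : L}
    (hu : u ∈ T) (hmin : ∀ x ∈ T, x = u ∨ lt u x) :
    ∃ β, IsAutCLt C lt β ∧ β u = c ∧ ∀ x ∈ T, x = u ∨ β x ∈ A := by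
  obtain ⟨U, huU, hU⟩ := hL.exists_forcing_min T hu hmin
  obtain ⟨α, hα, hαu, hαU⟩ := hA.2 U u huU
  obtain ⟨β, hβ, hβu, h⟩ := hU α hα (by
    intro x hx
    rcases hαU x hx with h | h
    · exact Or.inl (α.injective (h.trans hαu.symm))
    · rw [hαu]
      exact Or.inr (hside _ h))
  rw [hαu] at hβu
  refine ⟨β, hβ, hβu, fun x hx => ?_⟩
  obtain ⟨y, hy, e⟩ := h x hx
  rcases hαU y hy with h' | h'
  · rw [e, ← hβu] at h'
    exact Or.inl (β.injective h')
  · rw [e] at h'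
    exact Or.inr h'

end

/-! ### The functions `lin`, and how to generate them -/

/-- A branching structure embeds every countable ordered leaf structure, by going forth along an
enumeration. -/
theorem exists_embedding_of_countable {V W : Type*} [Nonempty W] [Countable V]
    {C : V → V → V → Prop} {lt : V → V → Prop} {C' : W → W → W → Prop} {lt' : W → W → Prop}
    (h : IsOrderedLeafStructure C lt) (h' : IsOrderedLeafStructure C' lt')
    (hbr : Branching C' lt') :
    ∃ f : V → W, (∀ x y z, C' (f x) (f y) (f z) ↔ C x y z) ∧
        ∀ x y, lt' (f x) (f y) ↔ lt x y := by
  classical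
  rcases isEmpty_or_nonempty V with hV | hV
  · exact ⟨fun _ => Classical.arbitrary W, fun x => hV.elim x, fun x => hV.elim x⟩
  obtain ⟨en, hen⟩ := exists_surjective_nat V
  have step : ∀ (T : {T : Finset (V × W) // IsPartialIso C lt C' lt' T}) (x : V),
      ∃ T' : {T : Finset (V × W) // IsPartialIso C lt C' lt' T},
        T.1 ⊆ T'.1 ∧ ∃ y, (x, y) ∈ T'.1 := by
    rintro ⟨T, hT⟩ x
    obtain ⟨y, hy⟩ := extend h h' hbr hT x
    exact ⟨⟨_, hy⟩, fun p hp => by simp [hp], y, by simp⟩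
  choose nxt n1 n2 using step
  let chain : ℕ → {T : Finset (V × W) // IsPartialIso C lt C' lt' T} :=
    fun n => Nat.rec ⟨∅, by simp [IsPartialIso]⟩ (fun k T => nxt T (en k)) n
  have hmono : Monotone fun n => (chain n).1 := monotone_nat_of_le_succ fun n => n1 _ _
  have hdom : ∀ x, ∃ y, ∃ n, (x, y) ∈ (chain n).1 := by
    intro x
    obtain ⟨k, rfl⟩ := hen x
    obtain ⟨y, hy⟩ := n2 (chain k) (en k)
    exact ⟨y, k + 1, hy⟩
  choose f n hf using hdom
  refine ⟨f, fun x y z => ?_, fun x y => ?_⟩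
  · have e1 := hmono (le_max_left (n x) (max (n y) (n z))) (hf x)
    have e2 := hmono ((le_max_left (n y) (n z)).trans (le_max_right (n x) _)) (hf y)
    have e3 := hmono ((le_max_right (n y) (n z)).trans (le_max_right (n x) _)) (hf z)
    exact ((chain (max (n x) (max (n y) (n z)))).2.1 _ e1 _ e2 _ e3).symm
  · have e1 := hmono (le_max_left (n x) (n y)) (hf x)
    have e2 := hmono (le_max_right (n x) (n y)) (hf y)
    exact ((chain (max (n x) (n y))).2.2 _ e1 _ e2).symm

section

variable {L : Type*} {C : L → L → L → Prop} {lt : L → L → Prop}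

/-- The C-relation of the comb in which every element branches off from all larger ones. -/
def combRel (lt : L → L → Prop) (x y z : L) : Prop :=
  (y = z ∧ x ≠ y) ∨ (lt x y ∧ lt x z)

theorem IsOrderedLeafStructure.combRel (h : IsOrderedLeafStructure C lt) :
    IsOrderedLeafStructure (combRel lt) lt := by
  obtain ⟨-, a6, a7, a8, a9⟩ := h
  refine ⟨⟨?_, ?_, ?_, ?_, ?_⟩, a6, a7, a8, ?_⟩ <;> simp only [_root_.combRel] <;> grind

theorem IsOrderedLeafLimit.exists_isLin (hL : IsOrderedLeafLimit C lt) :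
    ∃ f : L → L, IsLin C lt f := by
  have := hL.nonempty
  have := hL.countable
  obtain ⟨f, h1, h2⟩ := exists_embedding_of_countable hL.combRel hL.toIsOrderedLeafStructure
    hL.branching
  exact ⟨f, fun x y => (h2 x y).2, fun x y z hxy hyz =>
    (h1 x y z).2 (Or.inr ⟨hxy, hL.trans _ _ _ hxy hyz⟩)⟩

/-- Every finite set is mapped to a comb, in increasing order, by some composition of elements
of `M`. -/
def GeneratesCombs (C : L → L → L → Prop) (lt : L → L → Prop) (M : Set (Function.End L)) : Prop :=
  ∀ F : Finset L, ∃ g ∈ Submonoid.closure M, ∀ x ∈ F, ∀ y ∈ F, ∀ z ∈ F, lt x y → lt y z →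
    C (g x) (g y) (g z)

/-- An injective map that sends increasing triples to combs pulls `C` back to `combRel`. -/
theorem rel_iff_combRel (h : IsOrderedLeafStructure C lt) {F : Finset L} {g : L → L}
    (hg : Function.Injective g)
    (hF : ∀ x ∈ F, ∀ y ∈ F, ∀ z ∈ F, lt x y → lt y z → C (g x) (g y) (g z)) :
    ∀ x ∈ F, ∀ y ∈ F, ∀ z ∈ F, C (g x) (g y) (g z) ↔ combRel lt x y z := by
  intro x hx y hy z hz
  have c0 := h.not_self
  have c1 := h.self
  have c2 := h.symm
  have c3 := h.asymm
  have d1 := h.total x y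
  have d2 := h.total y z
  have d3 := h.total x z
  have d4 := h.trans
  have d5 := h.irrefl
  unfold combRel
  by_cases hyz : y = z
  · subst hyz
    by_cases hxy : x = y
    · subst hxy
      simp [c0, d5]
    · simp [hxy, c1 _ _ (hg.ne hxy)]
  by_cases hxy : x = y
  · subst hxy
    simp [c0, d5]
  by_cases hxz : x = z
  · subst hxz
    have : ¬ C (g x) (g y) (g x) := fun h0 => c0 _ _ (c2 _ _ _ h0)
    simp [this, d5, Ne.symm hxy]
  grind

theorem injective_of_mem_closure {M : Set (Function.End L)}
    (hM : ∀ g ∈ M, Function.Injective g) {g : Function.End L} (hg : g ∈ Submonoid.closure M) :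
    Function.Injective g := by
  induction hg using Submonoid.closure_induction with
  | mem g hg => exact hM g hg
  | one => exact fun _ _ h => h
  | mul f g _ _ hf hg => exact hf.comp hg

theorem autC_mem_closure {M : Set (Function.End L)} (hM : autC C ⊆ M) {α : Equiv.Perm L}
    (hα : IsAutC C α) : (⇑α : Function.End L) ∈ Submonoid.closure M :=
  Submonoid.subset_closure (hM ⟨α, hα, rfl⟩)

theorem comp_mem_closure {M : Set (Function.End L)} {f g : L → L}
    (hf : (f : Function.End L) ∈ Submonoid.closure M)
    (hg : (g : Function.End L) ∈ Submonoid.closure M) :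
    ((f ∘ g : L → L) : Function.End L) ∈ Submonoid.closure M := mul_mem hf hg

theorem injective_of_mem_generators {e : L → L} (he : Function.Injective e) :
    ∀ g ∈ ({e} ∪ autC C : Set (Function.End L)), Function.Injective g := by
  rintro g (rfl | ⟨α, -, rfl⟩)
  · exact he
  · exact α.injective

theorem comp_aut_mem_closure {e : L → L} {α : Equiv.Perm L} (hα : IsAutC C α) :
    ((e ∘ α : L → L) : Function.End L) ∈
      Submonoid.closure ({e} ∪ autC C : Set (Function.End L)) :=
  comp_mem_closure (f := e) (Submonoid.subset_closure (Or.inl rfl))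
    (autC_mem_closure Set.subset_union_right hα)

/-- Two combs on the same ordered set differ by an automorphism of `(L; C)`. -/
theorem GeneratesCombs.generatesLin (hL : IsOrderedLeafLimit C lt) {M : Set (Function.End L)}
    (hM : autC C ⊆ M) (hMi : ∀ g ∈ M, Function.Injective g) (h : GeneratesCombs C lt M) :
    GeneratesLin C lt M := by
  refine ⟨hL.exists_isLin, fun f hf F => ?_⟩
  obtain ⟨g, hg, hgF⟩ := h F
  have hgi := injective_of_mem_closure hMi hg
  have hfi : Function.Injective f := by
    intro x y e
    by_contra hne
    rcases hL.total _ _ hne with h | h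
    · exact hL.irrefl _ (e ▸ hf.1 _ _ h)
    · exact hL.irrefl _ (e ▸ hf.1 _ _ h)
  have e1 := rel_iff_combRel hL.toIsOrderedLeafStructure hgi hgF
  have e2 := rel_iff_combRel hL.toIsOrderedLeafStructure (F := F) hfi
    fun x _ y _ z _ => hf.2 x y z
  obtain ⟨α, hα, hαe⟩ := hL.homogeneousC_family (fun x : F => g x.1) (fun x => f x.1)
    (fun i j k => by rw [e1 _ i.2 _ j.2 _ k.2, e2 _ i.2 _ j.2 _ k.2])
  exact ⟨α ∘ g, comp_mem_closure (autC_mem_closure hM hα) hg, fun x hx => hαe ⟨x, hx⟩⟩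

/-- Every finite set can be reversed by an automorphism of `(L; C)`, so it does not matter in
which direction combs are generated. -/
theorem GeneratesCombs.of_flip (hL : IsOrderedLeafLimit C lt) {M : Set (Function.End L)}
    (hM : autC C ⊆ M) (h : GeneratesCombs C (flip lt) M) : GeneratesCombs C lt M := by
  classical
  intro F
  have := hL.nonempty
  obtain ⟨f, hf1, hf2⟩ := exists_embedding
    (hL.flip.toIsOrderedLeafStructure.comap (Subtype.val_injective (p := (· ∈ F))))
    hL.toIsOrderedLeafStructure hL.branching
  obtain ⟨α, hα, hαe⟩ := hL.homogeneousC_family (fun x : F => x.1) f hf1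
  obtain ⟨g, hg, hgF⟩ := h (F.image α)
  refine ⟨g ∘ α, comp_mem_closure hg (autC_mem_closure hM hα), ?_⟩
  intro x hx y hy z hz hxy hyz
  refine hgF _ (Finset.mem_image_of_mem _ hx) _ (Finset.mem_image_of_mem _ hy) _
    (Finset.mem_image_of_mem _ hz) ?_ ?_
  · have := (hf2 ⟨y, hy⟩ ⟨x, hx⟩).2 hxy
    rwa [← hαe, ← hαe] at this
  · have := (hf2 ⟨z, hz⟩ ⟨y, hy⟩).2 hyz
    rwa [← hαe, ← hαe] at this

/-- If any single leaf of a finite tree can be moved to the top while the rest of the tree is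
kept, then all combs are generated: the leaves are moved to the top one after another, from the
largest to the smallest. -/
theorem generatesCombs_of_pull (h : IsOrderedLeafStructure C lt) {M : Set (Function.End L)}
    (hMi : ∀ g ∈ M, Function.Injective g)
    (hpull : ∀ F : Finset L, ∀ u ∈ F, ∃ g ∈ Submonoid.closure M,
      (∀ y ∈ F, y ≠ u → ∀ z ∈ F, z ≠ u → C (g u) (g y) (g z)) ∧
      ∀ x ∈ F, x ≠ u → ∀ y ∈ F, y ≠ u → ∀ z ∈ F, z ≠ u → C x y z → C (g x) (g y) (g z)) :
    GeneratesCombs C lt M := by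
  classical
  intro F
  induction F using Finset.strongInduction with
  | H F ih =>
  rcases F.eq_empty_or_nonempty with rfl | hne
  · exact ⟨1, one_mem _, by simp⟩
  obtain ⟨m, hm, hmin⟩ := h.exists_min hne
  obtain ⟨g, hg, hgF⟩ := ih (F.erase m) (Finset.erase_ssubset hm)
  have hgi := injective_of_mem_closure hMi hg
  obtain ⟨p, hp, hp1, hp2⟩ := hpull (F.image g) (g m) (Finset.mem_image_of_mem _ hm)
  refine ⟨p ∘ g, comp_mem_closure hp hg, ?_⟩
  intro x hx y hy z hz hxy hyz
  have hne : ∀ w ∈ F, ∀ w', lt w' w → w' ∈ F → w ≠ m := by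
    rintro w - w' hw hw' rfl
    rcases hmin w' hw' with rfl | h0
    · exact h.irrefl _ hw
    · exact h.irrefl _ (h.trans _ _ _ hw h0)
  have hym := hne y hy x hxy hx
  have hzm := hne z hz y hyz hy
  by_cases hxm : x = m
  · subst hxm
    exact hp1 _ (Finset.mem_image_of_mem _ hy) (hgi.ne hym) _ (Finset.mem_image_of_mem _ hz)
      (hgi.ne hzm)
  · exact hp2 _ (Finset.mem_image_of_mem _ hx) (hgi.ne hxm) _ (Finset.mem_image_of_mem _ hy)
      (hgi.ne hym) _ (Finset.mem_image_of_mem _ hz) (hgi.ne hzm)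
      (hgF x (by simp [hx, hxm]) y (by simp [hy, hym]) z (by simp [hz, hzm]) hxy hyz)

end

section

variable {L : Type*} {C : L → L → L → Prop} {lt : L → L → Prop}

/-! ### Configurations in the limit structure -/

theorem IsOrderedLeafLimit.exists_increasing (hL : IsOrderedLeafLimit C lt) :
    ∃ p : ℕ → L, ∀ i j, i < j → lt (p i) (p j) := by
  have step : ∀ x, ∃ y, lt x y := by
    intro x
    obtain ⟨γ, -, -, h⟩ := hL.exists_setSep {x} {x}
    exact ⟨γ x, h x (by simp) x (by simp)⟩
  choose s hs using step
  obtain ⟨x⟩ := hL.nonempty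
  refine ⟨fun n => Nat.rec x (fun _ y => s y) n, fun i j hij => ?_⟩
  induction j, hij using Nat.le_induction with
  | base => exact hs _
  | succ j _ ih => exact hL.trans _ _ _ ih (hs _)

/-- There are infinite increasing combs. -/
theorem IsOrderedLeafLimit.exists_comb (hL : IsOrderedLeafLimit C lt) :
    ∃ q : ℕ → L, (∀ i j, i < j → lt (q i) (q j)) ∧
      ∀ i j k, i < j → j < k → C (q i) (q j) (q k) := by
  obtain ⟨p, hp⟩ := hL.exists_increasing
  obtain ⟨f, h1, h2⟩ := hL.exists_isLin
  exact ⟨f ∘ p, fun i j hij => h1 _ _ (hp i j hij),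
    fun i j k hij hjk => h2 _ _ _ (hp i j hij) (hp j k hjk)⟩

/-- In increasing families, the C-relation is determined by its values at increasing triples. -/
theorem rel_iff_of_increasing (h : IsOrderedLeafStructure C lt) {n : ℕ} {s t : Fin n → L}
    (hs : ∀ i j, i < j → lt (s i) (s j)) (ht : ∀ i j, i < j → lt (t i) (t j))
    (hst : ∀ i j k, i < j → j < k → (C (t i) (t j) (t k) ↔ C (s i) (s j) (s k))) (i j k : Fin n) :
    C (t i) (t j) (t k) ↔ C (s i) (s j) (s k) := by
  have aux : ∀ r : Fin n → L, (∀ i j, i < j → lt (r i) (r j)) → ∀ i j k, i < j → j < k →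
      ¬ C (r j) (r i) (r k) ∧ (C (r k) (r i) (r j) ↔ ¬ C (r i) (r j) (r k)) := by
    intro r hr i j k hij hjk
    have e1 := h.convex _ _ _ (hr i j hij) (hr j k hjk)
    have e2 := h.symm (r k) (r i) (r j)
    have e3 := h.asymm
    have e4 := h.symm
    grind
  have hs' := aux s hs
  have ht' := aux t ht
  have h0 := h.not_self
  have h1 := h.symm
  have h2 : ∀ r : Fin n → L, (∀ i j, i < j → lt (r i) (r j)) → ∀ i j, i ≠ j →
      C (r i) (r j) (r j) := by
    intro r hr i j hij
    apply h.self
    intro e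
    rcases lt_or_gt_of_ne hij with h' | h'
    · exact h.irrefl _ (e ▸ hr _ _ h')
    · exact h.irrefl _ (e ▸ hr _ _ h')
  have hs2 := h2 s hs
  have ht2 := h2 t ht
  by_cases hij : i = j
  · subst hij
    simp [h0]
  by_cases hik : i = k
  · subst hik
    exact iff_of_false (fun e => h0 _ _ (h1 _ _ _ e)) (fun e => h0 _ _ (h1 _ _ _ e))
  by_cases hjk : j = k
  · subst hjk
    exact iff_of_true (ht2 _ _ hij) (hs2 _ _ hij)
  have hsy : ∀ r : Fin n → L, ∀ i j k, C (r i) (r j) (r k) ↔ C (r i) (r k) (r j) :=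
    fun r i j k => ⟨h1 _ _ _, h1 _ _ _⟩
  rcases lt_or_gt_of_ne hij with hij | hij <;> rcases lt_or_gt_of_ne hik with hik | hik <;>
    rcases lt_or_gt_of_ne hjk with hjk | hjk
  · exact hst _ _ _ hij hjk
  · rw [hsy t, hsy s]
    exact hst _ _ _ hik hjk
  · exact absurd (hij.trans hjk) hik.not_gt
  · rw [hsy t, hsy s]
    exact iff_of_false (ht' _ _ _ hik hij).1 (hs' _ _ _ hik hij).1
  · exact iff_of_false (ht' _ _ _ hij hik).1 (hs' _ _ _ hij hik).1
  · exact absurd (hjk.trans hij) hik.not_gt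
  · rw [(ht' _ _ _ hjk hik).2, (hs' _ _ _ hjk hik).2, hst _ _ _ hjk hik]
  · rw [hsy t, hsy s, (ht' _ _ _ hjk hij).2, (hs' _ _ _ hjk hij).2, hst _ _ _ hjk hij]

/-! ### Canonical functions above `c` -/

/-- An injective canonical function on a `c`-universal set all of whose elements lie above `c`. -/
structure CanonicalAbove (C : L → L → L → Prop) (lt : L → L → Prop) (c : L) (e : L → L)
    (A : Set L) : Prop where
  limit : IsOrderedLeafLimit C lt
  above : ∀ x ∈ A, lt c x
  universal : IsUniversalAt C c A
  injective : Function.Injective e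
  canonical : CanonicalOnWithConst C lt c e A

variable {c : L} {e : L → L} {A : Set L}

namespace CanonicalAbove

/-- Increasing families in `A ∪ {c}` that start with `c` and agree on `C` have images in the same
orbit. -/
theorem canonical_increasing (h : CanonicalAbove C lt c e A) {n : ℕ} {s t : Fin (n + 1) → L}
    (hs0 : s 0 = c) (ht0 : t 0 = c) (hsA : ∀ i, s i ∈ insert c A) (htA : ∀ i, t i ∈ insert c A)
    (hs : ∀ i j, i < j → lt (s i) (s j)) (ht : ∀ i j, i < j → lt (t i) (t j))
    (hst : ∀ i j k, i < j → j < k → (C (t i) (t j) (t k) ↔ C (s i) (s j) (s k))) :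
    ∃ β, IsAutC C β ∧ ∀ i, e (t i) = β (e (s i)) := by
  have hl : ∀ i j, lt (t i) (t j) ↔ lt (s i) (s j) := by
    intro i j
    have h1 := h.limit.irrefl
    have h2 := h.limit.trans
    have h3 := hs i j
    have h4 := hs j i
    have h5 := ht i j
    have h6 := ht j i
    rcases lt_trichotomy i j with hij | hij | hij
    · exact iff_of_true (h5 hij) (h3 hij)
    · subst hij
      simp [h1]
    · exact iff_of_false (fun h0 => h1 _ (h2 _ _ _ h0 (h6 hij)))
        (fun h0 => h1 _ (h2 _ _ _ h0 (h4 hij)))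
  obtain ⟨α, hα, hαe⟩ := h.limit.homogeneous_family s t
    (rel_iff_of_increasing h.limit.toIsOrderedLeafStructure hs ht hst) hl
  obtain ⟨β, hβ, hβe⟩ := h.canonical (n + 1) s hsA α ⟨hα, by rw [← hs0, hαe, ht0, hs0]⟩
    (fun i => by rw [hαe]; exact htA i)
  exact ⟨β, hβ.1, fun i => by rw [← hβe, hαe]⟩

theorem canonical_pair (h : CanonicalAbove C lt c e A) {x y x' y' : L} (hx : x ∈ A) (hy : y ∈ A)
    (hx' : x' ∈ A) (hy' : y' ∈ A) (hxy : lt x y) (hxy' : lt x' y') (h1 : C c x' y' ↔ C c x y) :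
    ∃ β, IsAutC C β ∧ e c = β (e c) ∧ e x' = β (e x) ∧ e y' = β (e y) := by
  have a1 := h.above x hx
  have a2 := h.above y hy
  have a3 := h.above x' hx'
  have a4 := h.above y' hy'
  obtain ⟨β, hβ, hβe⟩ := h.canonical_increasing (n := 2) (s := ![c, x, y]) (t := ![c, x', y'])
    rfl rfl (by simp [Fin.forall_fin_succ, *]) (by simp [Fin.forall_fin_succ, *])
    (by simp [Fin.forall_fin_succ, *]) (by simp [Fin.forall_fin_succ, *])
    (by simp [Fin.forall_fin_succ, *])
  exact ⟨β, hβ, hβe 0, hβe 1, hβe 2⟩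

theorem canonical_triple (h : CanonicalAbove C lt c e A) {x y z x' y' z' : L} (hx : x ∈ A)
    (hy : y ∈ A) (hz : z ∈ A) (hx' : x' ∈ A) (hy' : y' ∈ A) (hz' : z' ∈ A) (hxy : lt x y)
    (hyz : lt y z) (hxy' : lt x' y') (hyz' : lt y' z') (h1 : C c x' y' ↔ C c x y)
    (h2 : C c x' z' ↔ C c x z) (h3 : C c y' z' ↔ C c y z) (h4 : C x' y' z' ↔ C x y z) :
    ∃ β, IsAutC C β ∧ e x' = β (e x) ∧ e y' = β (e y) ∧ e z' = β (e z) := by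
  have a1 := h.above x hx
  have a2 := h.above y hy
  have a3 := h.above z hz
  have a4 := h.above x' hx'
  have a5 := h.above y' hy'
  have a6 := h.above z' hz'
  have a7 := h.limit.trans _ _ _ hxy hyz
  have a8 := h.limit.trans _ _ _ hxy' hyz'
  obtain ⟨β, hβ, hβe⟩ := h.canonical_increasing (n := 3) (s := ![c, x, y, z])
    (t := ![c, x', y', z'])
    rfl rfl (by simp [Fin.forall_fin_succ, *]) (by simp [Fin.forall_fin_succ, *])
    (by simp [Fin.forall_fin_succ, *]) (by simp [Fin.forall_fin_succ, *])
    (by simp [Fin.forall_fin_succ, *])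
  exact ⟨β, hβ, hβe 1, hβe 2, hβe 3⟩

/-- All triples of one type are mapped in the same one of the three possible ways. -/
theorem three_options (h : CanonicalAbove C lt c e A) {τ : L → L → L → Prop}
    (hτ : ∀ x y z, τ x y z → x ≠ y ∧ y ≠ z ∧ x ≠ z)
    (hβ : ∀ x y z x' y' z', τ x y z → τ x' y' z' →
      ∃ β, IsAutC C β ∧ e x' = β (e x) ∧ e y' = β (e y) ∧ e z' = β (e z)) :
    (∀ x y z, τ x y z → C (e x) (e y) (e z)) ∨ (∀ x y z, τ x y z → C (e y) (e x) (e z)) ∨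
      ∀ x y z, τ x y z → C (e z) (e x) (e y) := by
  by_cases hne : ∃ x y z, τ x y z
  · obtain ⟨x, y, z, h0⟩ := hne
    obtain ⟨n1, n2, n3⟩ := hτ x y z h0
    rcases h.limit.binary _ _ _ (h.injective.ne n1) (h.injective.ne n2) (h.injective.ne n3)
      with h1 | h1 | h1
    · left
      intro x' y' z' h2
      obtain ⟨β, hβ, e1, e2, e3⟩ := hβ _ _ _ _ _ _ h0 h2
      rw [e1, e2, e3]
      exact (hβ _ _ _).2 h1
    · right; left
      intro x' y' z' h2
      obtain ⟨β, hβ, e1, e2, e3⟩ := hβ _ _ _ _ _ _ h0 h2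
      rw [e1, e2, e3]
      exact (hβ _ _ _).2 h1
    · right; right
      intro x' y' z' h2
      obtain ⟨β, hβ, e1, e2, e3⟩ := hβ _ _ _ _ _ _ h0 h2
      rw [e1, e2, e3]
      exact (hβ _ _ _).2 h1
  · left
    intro x y z h0
    exact absurd ⟨x, y, z, h0⟩ hne

/-- Every finite set has an ordered copy inside a single cone of `A`, such that `A` also contains
an element closer to `c` and an element further away from `c`. -/
theorem exists_host (h : CanonicalAbove C lt c e A) (F : Finset L) :
    ∃ β, IsAutCLt C lt β ∧ (∀ x ∈ F, β x ∈ A) ∧ (∀ x ∈ F, ∀ y ∈ F, C c (β x) (β y)) ∧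
      ∃ p ∈ A, ∃ q ∈ A, ∀ x ∈ F, C (β x) c p ∧ C q c (β x) := by
  classical
  -- from `u`, which is sent to `c`, branch off first the close element, then the copy of `F`, and
  -- last the far element
  obtain ⟨u⟩ := h.limit.nonempty
  obtain ⟨γ₁, -, -, l1⟩ := h.limit.exists_setSep {u} {u}
  obtain ⟨γ₂, g2, s2, l2⟩ := h.limit.exists_setSep {u, γ₁ u} F
  obtain ⟨γ₃, -, s3, l3⟩ := h.limit.exists_setSep ({u, γ₁ u} ∪ F.image γ₂) {u}
  have hu1 : lt u (γ₁ u) := l1 u (by simp) u (by simp)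
  have hu2 : ∀ x ∈ F, lt u (γ₂ x) := fun x hx => l2 u (by simp) x hx
  have hu3 : lt u (γ₃ u) := l3 u (by simp) u (by simp)
  obtain ⟨β, hβ, hβu, hβA⟩ := h.universal.exists_isAutCLt h.limit h.above
    ({u, γ₁ u} ∪ F.image γ₂ ∪ {γ₃ u}) (u := u) (by simp) (by
      intro x hx
      simp only [Finset.mem_union, Finset.mem_insert, Finset.mem_singleton,
        Finset.mem_image] at hx
      rcases hx with ((rfl | rfl) | ⟨y, hy, rfl⟩) | rfl
      · exact Or.inl rfl
      · exact Or.inr hu1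
      · exact Or.inr (hu2 y hy)
      · exact Or.inr hu3)
  have hne : ∀ x, lt u x → x ≠ u := by
    rintro x hx rfl
    exact h.limit.irrefl _ hx
  refine ⟨γ₂.trans β, g2.trans hβ, ?_, ?_, β (γ₁ u), ?_, β (γ₃ u), ?_, ?_⟩
  · intro x hx
    refine (hβA (γ₂ x) ?_).resolve_left (hne _ (hu2 x hx))
    simp only [Finset.mem_union, Finset.mem_image]
    exact Or.inl (Or.inr ⟨x, hx, rfl⟩)
  · intro x hx y hy
    rw [← hβu]
    exact (hβ.1 _ _ _).2 (s2.2 u (by simp) _ (Set.mem_image_of_mem _ hx) _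
      (Set.mem_image_of_mem _ hy))
  · exact (hβA (γ₁ u) (by simp)).resolve_left (hne _ hu1)
  · exact (hβA (γ₃ u) (by simp)).resolve_left (hne _ hu3)
  · intro x hx
    rw [← hβu]
    refine ⟨(hβ.1 _ _ _).2 (s2.1 u (by simp) _ (by simp) _ (Set.mem_image_of_mem _ hx)),
      (hβ.1 _ _ _).2 (s3.1 u (by simp) _ ?_ _ (Set.mem_image_of_mem _ (by simp)))⟩
    simp only [Finset.coe_union, Finset.coe_image]
    exact Or.inr (Set.mem_image_of_mem _ hx)

/-- If finite sets can be placed so that the pairs `x ≺ y` satisfy `e(x) | p e(y)` for a fixed `p`,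
then combs are generated: `e(x) | p e(y)` and `e(x) | p e(z)` imply `e(x) | e(y) e(z)`. -/
theorem generatesCombs_of_point {lt' : L → L → Prop} (h : IsBinaryCRelation C)
    (H : ∀ F : Finset L, ∃ β, IsAutC C β ∧ ∃ p, ∀ x ∈ F, ∀ y ∈ F, lt' x y →
      C (e (β x)) p (e (β y)))
    (ht : ∀ x y z, lt' x y → lt' y z → lt' x z) : GeneratesCombs C lt' ({e} ∪ autC C) := by
  intro F
  obtain ⟨β, hβ, p, hp⟩ := H F
  refine ⟨e ∘ β, comp_aut_mem_closure hβ, ?_⟩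
  intro x hx y hy z hz hxy hyz
  exact h.join (hp x hx y hy hxy) (hp x hx z hz (ht _ _ _ hxy hyz))

end CanonicalAbove

end

section

variable {L : Type*} {C : L → L → L → Prop} {lt : L → L → Prop} {c : L} {e : L → L} {A : Set L}

namespace CanonicalAbove

theorem not_generatesCombs_flip (h : CanonicalAbove C lt c e A)
    (hn : ¬ GeneratesCombs C lt ({e} ∪ autC C)) : ¬ GeneratesCombs C (flip lt) ({e} ∪ autC C) :=
  fun h0 => hn (h0.of_flip h.limit Set.subset_union_right)

/-! ### The behaviour of `e` inside a cone -/

/-- Between `x` and `y` in the same cone, everything lies in that cone. -/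
theorem sameCone_of_between (h : CanonicalAbove C lt c e A) {x y z : L} (hxy : lt x y)
    (hyz : lt y z) (hc : C c x z) : C c x y ∧ C c y z := by
  have h1 := h.limit.convex _ _ _ hxy hyz
  have h2 := h.limit.cut _ _ _ y hc
  have h3 := h.limit.asymm
  have h4 := h.limit.symm
  have h5 : C c y z := by grind
  exact ⟨h4 _ _ _ (h.limit.join (h4 _ _ _ h5) (h4 _ _ _ hc)), h5⟩

/-- If `e` turned each of the two kinds of triples into the other, it would be inconsistent on a
tree with two cherries. -/
theorem cone_not_swap (h : CanonicalAbove C lt c e A)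
    (h1 : ∀ x ∈ A, ∀ y ∈ A, ∀ z ∈ A, lt x y → lt y z → C c x z → C x y z → C (e z) (e x) (e y))
    (h2 : ∀ x ∈ A, ∀ y ∈ A, ∀ z ∈ A, lt x y → lt y z → C c x z → C z x y → C (e x) (e y) (e z)) :
    False := by
  classical
  obtain ⟨p, hp⟩ := h.limit.exists_increasing
  have hp' := hp 0 1 (by omega)
  obtain ⟨γ, hγ, s, l⟩ := h.limit.exists_setSep {p 0, p 1} {p 0, p 1}
  obtain ⟨β, hβ, hA, hc, -⟩ := h.exists_host {p 0, p 1, γ (p 0), γ (p 1)}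
  have a1 := hA (p 0) (by simp)
  have a2 := hA (p 1) (by simp)
  have a3 := hA (γ (p 0)) (by simp)
  have a4 := hA (γ (p 1)) (by simp)
  have l1 := (hβ.2 _ _).2 hp'
  have l2 := (hβ.2 _ _).2 (l (p 1) (by simp) (p 0) (by simp))
  have l3 := (hβ.2 _ _).2 ((hγ.2 _ _).2 hp')
  have m0 : γ (p 0) ∈ γ '' (({p 0, p 1} : Finset L) : Set L) := Set.mem_image_of_mem _ (by simp)
  have m1 : γ (p 1) ∈ γ '' (({p 0, p 1} : Finset L) : Set L) := Set.mem_image_of_mem _ (by simp)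
  have r1 := h2 _ a1 _ a2 _ a3 l1 l2 (hc _ (by simp) _ (by simp))
    ((hβ.1 _ _ _).2 (s.1 _ (by simp) _ (by simp) _ m0))
  have r2 := h2 _ a1 _ a2 _ a4 l1 (h.limit.trans _ _ _ l2 l3) (hc _ (by simp) _ (by simp))
    ((hβ.1 _ _ _).2 (s.1 _ (by simp) _ (by simp) _ m1))
  have r3 := h1 _ a1 _ a3 _ a4 (h.limit.trans _ _ _ l1 l2) l3 (hc _ (by simp) _ (by simp))
    ((hβ.1 _ _ _).2 (s.2 _ (by simp) _ m0 _ m1))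
  have r4 := h.limit.join r1 r2
  exact h.limit.asymm _ _ _ (h.limit.symm _ _ _ r4) r3

/-- On a comb with four elements `x, y, z, w`, it is inconsistent that in each triple the middle
element branches off first. -/
theorem not_middle {D : L → L → L → Prop} (hD : IsBinaryCRelation D) {x y z w : L}
    (h1 : D y x z) (h2 : D y x w) (h3 : D z y w) : False :=
  hD.asymm _ _ _ (hD.join h1 h2) h3

/-- Triples `x ≺ y ≺ z` in a cone with `x | y z`: by `not_middle`, all of them keep their shape or
all of them are sent to the opposite shape. -/
theorem cone_left (h : CanonicalAbove C lt c e A) :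
    (∀ x ∈ A, ∀ y ∈ A, ∀ z ∈ A, lt x y → lt y z → C c x z → C x y z → C (e x) (e y) (e z)) ∨
    ∀ x ∈ A, ∀ y ∈ A, ∀ z ∈ A, lt x y → lt y z → C c x z → C x y z → C (e z) (e x) (e y) := by
  classical
  have ir := h.limit.irrefl
  have tr := h.limit.trans
  rcases h.three_options
    (τ := fun x y z => x ∈ A ∧ y ∈ A ∧ z ∈ A ∧ lt x y ∧ lt y z ∧ C c x z ∧ C x y z)
    (by grind)
    (by
      rintro x y z x' y' z' ⟨a1, a2, a3, l1, l2, c1, d1⟩ ⟨a1', a2', a3', l1', l2', c1', d1'⟩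
      have b := h.sameCone_of_between l1 l2 c1
      have b' := h.sameCone_of_between l1' l2' c1'
      exact h.canonical_triple a1 a2 a3 a1' a2' a3' l1 l2 l1' l2' (iff_of_true b'.1 b.1)
        (iff_of_true c1' c1) (iff_of_true b'.2 b.2) (iff_of_true d1' d1)) with h0 | h0 | h0
  · left
    intro x a1 y a2 z a3 l1 l2 c1 d1
    exact h0 x y z ⟨a1, a2, a3, l1, l2, c1, d1⟩
  · exfalso
    obtain ⟨q, hq, hqc⟩ := h.limit.exists_comb
    obtain ⟨β, hβ, hA, hc, -⟩ := h.exists_host ((Finset.range 4).image q)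
    have hm : ∀ i < 4, q i ∈ (Finset.range 4).image q := fun i hi =>
      Finset.mem_image_of_mem _ (Finset.mem_range.2 hi)
    have key : ∀ i j k, i < j → j < k → k < 4 →
        C (e (β (q j))) (e (β (q i))) (e (β (q k))) := fun i j k hij hjk hk =>
      h0 _ _ _ ⟨hA _ (hm i (by omega)), hA _ (hm j (by omega)), hA _ (hm k hk),
        (hβ.2 _ _).2 (hq _ _ hij), (hβ.2 _ _).2 (hq _ _ hjk), hc _ (hm i (by omega)) _ (hm k hk),
        (hβ.1 _ _ _).2 (hqc _ _ _ hij hjk)⟩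
    exact not_middle h.limit.toIsBinaryCRelation
      (key 0 1 2 (by omega) (by omega) (by omega)) (key 0 1 3 (by omega) (by omega) (by omega))
      (key 1 2 3 (by omega) (by omega) (by omega))
  · right
    intro x a1 y a2 z a3 l1 l2 c1 d1
    exact h0 x y z ⟨a1, a2, a3, l1, l2, c1, d1⟩

/-- Triples `x ≺ y ≺ z` in a cone with `x y | z`: by `not_middle`, all of them keep their shape or
all of them are sent to the opposite shape. -/
theorem cone_right (h : CanonicalAbove C lt c e A) :
    (∀ x ∈ A, ∀ y ∈ A, ∀ z ∈ A, lt x y → lt y z → C c x z → C z x y → C (e x) (e y) (e z)) ∨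
    ∀ x ∈ A, ∀ y ∈ A, ∀ z ∈ A, lt x y → lt y z → C c x z → C z x y → C (e z) (e x) (e y) := by
  classical
  have ir := h.limit.irrefl
  have tr := h.limit.trans
  have hCn : ∀ x y z, C z x y → ¬ C x y z := fun x y z h1 h2 =>
    h.limit.asymm _ _ _ h1 (h.limit.symm _ _ _ h2)
  rcases h.three_options
    (τ := fun x y z => x ∈ A ∧ y ∈ A ∧ z ∈ A ∧ lt x y ∧ lt y z ∧ C c x z ∧ C z x y)
    (by grind)
    (by
      rintro x y z x' y' z' ⟨a1, a2, a3, l1, l2, c1, d1⟩ ⟨a1', a2', a3', l1', l2', c1', d1'⟩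
      have b := h.sameCone_of_between l1 l2 c1
      have b' := h.sameCone_of_between l1' l2' c1'
      exact h.canonical_triple a1 a2 a3 a1' a2' a3' l1 l2 l1' l2' (iff_of_true b'.1 b.1)
        (iff_of_true c1' c1) (iff_of_true b'.2 b.2) (iff_of_false (hCn _ _ _ d1') (hCn _ _ _ d1)))
    with h0 | h0 | h0
  · left
    intro x a1 y a2 z a3 l1 l2 c1 d1
    exact h0 x y z ⟨a1, a2, a3, l1, l2, c1, d1⟩
  · exfalso
    obtain ⟨q, hq, hqc⟩ := h.limit.flip.exists_comb
    obtain ⟨β, hβ, hA, hc, -⟩ := h.exists_host ((Finset.range 4).image q)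
    have hm : ∀ i < 4, q i ∈ (Finset.range 4).image q := fun i hi =>
      Finset.mem_image_of_mem _ (Finset.mem_range.2 hi)
    have key : ∀ i j k, i < j → j < k → k < 4 →
        C (e (β (q j))) (e (β (q i))) (e (β (q k))) := fun i j k hij hjk hk =>
      h.limit.symm _ _ _ (h0 _ _ _ ⟨hA _ (hm k hk), hA _ (hm j (by omega)), hA _ (hm i (by omega)),
        (hβ.2 _ _).2 (hq _ _ hjk), (hβ.2 _ _).2 (hq _ _ hij), hc _ (hm k hk) _ (hm i (by omega)),
        h.limit.symm _ _ _ ((hβ.1 _ _ _).2 (hqc _ _ _ hij hjk))⟩)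
    exact not_middle h.limit.toIsBinaryCRelation
      (key 0 1 2 (by omega) (by omega) (by omega)) (key 0 1 3 (by omega) (by omega) (by omega))
      (key 1 2 3 (by omega) (by omega) (by omega))
  · right
    intro x a1 y a2 z a3 l1 l2 c1 d1
    exact h0 x y z ⟨a1, a2, a3, l1, l2, c1, d1⟩

theorem between_rel (h : CanonicalAbove C lt c e A) {x y z : L} (hxy : lt x y) (hyz : lt y z) :
    C x y z ∨ C z x y := (h.limit.convex _ _ _ hxy hyz).symm

/-- If both types of triples in a cone are sent to one shape, then `e` turns finite subsets of the
cone into increasing or decreasing combs. -/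
theorem cone_preserves (h : CanonicalAbove C lt c e A)
    (hn : ¬ GeneratesCombs C lt ({e} ∪ autC C)) :
    ∀ x ∈ A, ∀ y ∈ A, ∀ z ∈ A, C c x y → C c x z → C x y z → C (e x) (e y) (e z) := by
  have main : (∀ x ∈ A, ∀ y ∈ A, ∀ z ∈ A, lt x y → lt y z → C c x z → C x y z →
        C (e x) (e y) (e z)) ∧
      ∀ x ∈ A, ∀ y ∈ A, ∀ z ∈ A, lt x y → lt y z → C c x z → C z x y → C (e z) (e x) (e y) := by
    rcases h.cone_left with h1 | h1 <;> rcases h.cone_right with h2 | h2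
    · refine absurd (fun F => ?_) hn
      obtain ⟨β, hβ, hA, hc, -⟩ := h.exists_host F
      refine ⟨e ∘ β, comp_aut_mem_closure hβ.1, fun x hx y hy z hz hxy hyz => ?_⟩
      have l1 := (hβ.2 _ _).2 hxy
      have l2 := (hβ.2 _ _).2 hyz
      rcases h.between_rel l1 l2 with h0 | h0
      · exact h1 _ (hA x hx) _ (hA y hy) _ (hA z hz) l1 l2 (hc x hx z hz) h0
      · exact h2 _ (hA x hx) _ (hA y hy) _ (hA z hz) l1 l2 (hc x hx z hz) h0
    · exact ⟨h1, h2⟩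
    · exact (h.cone_not_swap h1 h2).elim
    · refine absurd (fun F => ?_) (h.not_generatesCombs_flip hn)
      obtain ⟨β, hβ, hA, hc, -⟩ := h.exists_host F
      refine ⟨e ∘ β, comp_aut_mem_closure hβ.1,
        fun z hz y hy x hx hyz hxy => h.limit.symm _ _ _ ?_⟩
      have l1 := (hβ.2 _ _).2 hxy
      have l2 := (hβ.2 _ _).2 hyz
      rcases h.between_rel l1 l2 with h0 | h0
      · exact h1 _ (hA x hx) _ (hA y hy) _ (hA z hz) l1 l2 (hc x hx z hz) h0
      · exact h2 _ (hA x hx) _ (hA y hy) _ (hA z hz) l1 l2 (hc x hx z hz) h0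
  obtain ⟨h1, h2⟩ := main
  intro x hx y hy z hz hxy hxz hC
  have sy := h.limit.symm
  have asy := h.limit.asymm
  have n1 := h.limit.ne_left hC
  have n2 := h.limit.ne_right hC
  have cyz : C c y z := h.limit.join hxy hxz
  by_cases hyz : y = z
  · subst hyz
    exact h.limit.self _ _ (h.injective.ne n1)
  have k1 := h1 x hx y hy z hz
  have k2 := h1 x hx z hz y hy
  have k3 := h2 y hy z hz x hx
  have k4 := h2 z hz y hy x hx
  have b1 := h.limit.convex y x z
  have b2 := h.limit.convex z x y
  have t1 := h.limit.total x y n1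
  have t2 := h.limit.total x z n2
  have t3 := h.limit.total y z hyz
  grind

/-! ### The behaviour of `e` between cones -/

/-- The cones above `c` are ordered by their distance from `c`. -/
theorem lt_of_farther (h : CanonicalAbove C lt c e A) {x y : L} (hy : y ∈ A) (hC : C y c x) :
    lt x y := by
  have n := h.limit.ne_right hC
  refine (h.limit.total x y (Ne.symm n)).resolve_right fun h0 => ?_
  have sy := h.limit.symm
  have asy := h.limit.asymm
  rcases h.limit.convex _ _ _ (h.above y hy) h0 with h1 | h1 <;> grind

/-- `e(c)` is separated from the image of each cone: otherwise it would serve as the point `p` in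
`generatesCombs_of_point`. -/
theorem pair_preserves (h : CanonicalAbove C lt c e A)
    (hn : ¬ GeneratesCombs C lt ({e} ∪ autC C)) :
    ∀ x ∈ A, ∀ y ∈ A, C c x y → C (e c) (e x) (e y) := by
  have ir := h.limit.irrefl
  have hc := h.above
  have main : ∀ x ∈ A, ∀ y ∈ A, lt x y → C c x y → C (e c) (e x) (e y) := by
    rcases h.three_options (τ := fun p x y => p = c ∧ x ∈ A ∧ y ∈ A ∧ lt x y ∧ C c x y)
      (by grind)
      (by
        rintro _ y z _ y' z' ⟨rfl, a2, a3, l1, c1⟩ ⟨rfl, a2', a3', l1', c1'⟩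
        exact h.canonical_pair a2 a3 a2' a3' l1 l1' (iff_of_true c1' c1)) with h0 | h0 | h0
    · exact fun x hx y hy l c1 => h0 c x y ⟨rfl, hx, hy, l, c1⟩
    · refine absurd ?_ hn
      refine generatesCombs_of_point h.limit.toIsBinaryCRelation (fun F => ?_) h.limit.trans
      obtain ⟨β, hβ, hA, hc, -⟩ := h.exists_host F
      exact ⟨β, hβ.1, e c, fun x hx y hy l =>
        h0 c _ _ ⟨rfl, hA x hx, hA y hy, (hβ.2 _ _).2 l, hc x hx y hy⟩⟩
    · refine absurd ?_ (h.not_generatesCombs_flip hn)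
      refine generatesCombs_of_point h.limit.toIsBinaryCRelation (fun F => ?_) h.limit.flip.trans
      obtain ⟨β, hβ, hA, hc, -⟩ := h.exists_host F
      exact ⟨β, hβ.1, e c, fun x hx y hy l =>
        h0 c _ _ ⟨rfl, hA y hy, hA x hx, (hβ.2 _ _).2 l, hc y hy x hx⟩⟩
  intro x hx y hy hC
  by_cases hxy : x = y
  · subst hxy
    exact h.limit.self _ _ (h.injective.ne (h.limit.ne_left hC))
  rcases h.limit.total _ _ hxy with l | l
  · exact main x hx y hy l hC
  · exact h.limit.symm _ _ _ (main y hy x hx l (h.limit.symm _ _ _ hC))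

/-- The image of a far element `z` is separated from the image of each nearer cone: otherwise it
would serve as the point `p` in `generatesCombs_of_point`. -/
theorem near_preserves (h : CanonicalAbove C lt c e A)
    (hn : ¬ GeneratesCombs C lt ({e} ∪ autC C)) :
    ∀ x ∈ A, ∀ y ∈ A, ∀ z ∈ A, C c x y → C z c x → C (e z) (e x) (e y) := by
  have ir := h.limit.irrefl
  have tr := h.limit.trans
  have sy := h.limit.symm
  have asy := h.limit.asymm
  have cu := h.limit.cut
  have far : ∀ x y z, C c x y → C z c x → C z c y ∧ C z x y := by
    intro x y z h1 h2
    have : C z c y := by grind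
    exact ⟨this, h.limit.join h2 this⟩
  have main : ∀ x ∈ A, ∀ y ∈ A, ∀ z ∈ A, lt x y → C c x y → C z c x →
      C (e z) (e x) (e y) := by
    rcases h.three_options
      (τ := fun x y z => x ∈ A ∧ y ∈ A ∧ z ∈ A ∧ lt x y ∧ C c x y ∧ C z c x)
      (by
        rintro x y z ⟨a1, a2, a3, l1, c1, d1⟩
        have l2 := h.lt_of_farther a3 (far _ _ _ c1 d1).1
        have l3 := tr _ _ _ l1 l2
        grind)
      (by
        rintro x y z x' y' z' ⟨a1, a2, a3, l1, c1, d1⟩ ⟨a1', a2', a3', l1', c1', d1'⟩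
        have f := far _ _ _ c1 d1
        have f' := far _ _ _ c1' d1'
        exact h.canonical_triple a1 a2 a3 a1' a2' a3' l1 (h.lt_of_farther a3 f.1) l1'
          (h.lt_of_farther a3' f'.1) (iff_of_true c1' c1)
          (iff_of_false (by grind) (by grind)) (iff_of_false (by grind) (by grind))
          (iff_of_false (by grind) (by grind))) with h0 | h0 | h0
    · refine absurd ?_ hn
      refine generatesCombs_of_point h.limit.toIsBinaryCRelation (fun F => ?_) h.limit.trans
      obtain ⟨β, hβ, hA, hc, p, hp, q, hq, hpq⟩ := h.exists_host F
      exact ⟨β, hβ.1, e q, fun x hx y hy l => h.limit.symm _ _ _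
        (h0 _ _ q ⟨hA x hx, hA y hy, hq, (hβ.2 _ _).2 l, hc x hx y hy, (hpq x hx).2⟩)⟩
    · refine absurd ?_ (h.not_generatesCombs_flip hn)
      refine generatesCombs_of_point h.limit.toIsBinaryCRelation (fun F => ?_) h.limit.flip.trans
      obtain ⟨β, hβ, hA, hc, p, hp, q, hq, hpq⟩ := h.exists_host F
      exact ⟨β, hβ.1, e q, fun x hx y hy l => h.limit.symm _ _ _
        (h0 _ _ q ⟨hA y hy, hA x hx, hq, (hβ.2 _ _).2 l, hc y hy x hx, (hpq y hy).2⟩)⟩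
    · exact fun x hx y hy z hz l c1 d1 => h0 x y z ⟨hx, hy, hz, l, c1, d1⟩
  intro x hx y hy z hz hC hd
  by_cases hxy : x = y
  · subst hxy
    exact h.limit.self _ _ (h.injective.ne (h.limit.ne_right hd))
  rcases h.limit.total _ _ hxy with l | l
  · exact main x hx y hy z hz l hC hd
  · exact sy _ _ _ (main y hy x hx z hz l (sy _ _ _ hC) (far _ _ _ hC hd).1)

/-- The image of a near element `x` is separated from the image of each farther cone: otherwise it
would serve as the point `p` in `generatesCombs_of_point`. -/
theorem far_preserves (h : CanonicalAbove C lt c e A)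
    (hn : ¬ GeneratesCombs C lt ({e} ∪ autC C)) :
    ∀ x ∈ A, ∀ y ∈ A, ∀ z ∈ A, C c y z → C y c x → C (e x) (e y) (e z) := by
  have ir := h.limit.irrefl
  have tr := h.limit.trans
  have sy := h.limit.symm
  have asy := h.limit.asymm
  have cu := h.limit.cut
  have far : ∀ x y z, C c y z → C y c x → C z c x ∧ C x y z := by
    intro x y z h1 h2
    have h3 : C x y z := by grind
    exact ⟨by grind, h3⟩
  have main : ∀ x ∈ A, ∀ y ∈ A, ∀ z ∈ A, lt y z → C c y z → C y c x →
      C (e x) (e y) (e z) := by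
    rcases h.three_options
      (τ := fun x y z => x ∈ A ∧ y ∈ A ∧ z ∈ A ∧ lt y z ∧ C c y z ∧ C y c x)
      (by
        rintro x y z ⟨a1, a2, a3, l1, c1, d1⟩
        have l2 := h.lt_of_farther a2 d1
        have l3 := tr _ _ _ l2 l1
        grind)
      (by
        rintro x y z x' y' z' ⟨a1, a2, a3, l1, c1, d1⟩ ⟨a1', a2', a3', l1', c1', d1'⟩
        have f := far _ _ _ c1 d1
        have f' := far _ _ _ c1' d1'
        exact h.canonical_triple a1 a2 a3 a1' a2' a3' (h.lt_of_farther a2 d1) l1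
          (h.lt_of_farther a2' d1') l1' (iff_of_false (by grind) (by grind))
          (iff_of_false (by grind) (by grind)) (iff_of_true c1' c1)
          (iff_of_true f'.2 f.2)) with h0 | h0 | h0
    · exact fun x hx y hy z hz l c1 d1 => h0 x y z ⟨hx, hy, hz, l, c1, d1⟩
    · refine absurd ?_ hn
      refine generatesCombs_of_point h.limit.toIsBinaryCRelation (fun F => ?_) h.limit.trans
      obtain ⟨β, hβ, hA, hc, p, hp, q, hq, hpq⟩ := h.exists_host F
      exact ⟨β, hβ.1, e p, fun x hx y hy l =>
        h0 p _ _ ⟨hp, hA x hx, hA y hy, (hβ.2 _ _).2 l, hc x hx y hy, (hpq x hx).1⟩⟩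
    · refine absurd ?_ (h.not_generatesCombs_flip hn)
      refine generatesCombs_of_point h.limit.toIsBinaryCRelation (fun F => ?_) h.limit.flip.trans
      obtain ⟨β, hβ, hA, hc, p, hp, q, hq, hpq⟩ := h.exists_host F
      exact ⟨β, hβ.1, e p, fun x hx y hy l =>
        h0 p _ _ ⟨hp, hA y hy, hA x hx, (hβ.2 _ _).2 l, hc y hy x hx, (hpq y hy).1⟩⟩
  intro x hx y hy z hz hC hd
  by_cases hyz : y = z
  · subst hyz
    exact h.limit.self _ _ (h.injective.ne (Ne.symm (h.limit.ne_right hd)))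
  rcases h.limit.total _ _ hyz with l | l
  · exact main x hx y hy z hz l hC hd
  · exact sy _ _ _ (main x hx z hz y hy l (sy _ _ _ hC) (far _ _ _ hC hd).1)

/-- All pairs of elements of different cones, `x` nearer to `c` than `y`, have images of the same
shape relative to `e(c)`. -/
theorem distinct_cones_pair (h : CanonicalAbove C lt c e A) :
    (∀ x ∈ A, ∀ y ∈ A, C y c x → C (e c) (e x) (e y)) ∨
    (∀ x ∈ A, ∀ y ∈ A, C y c x → C (e x) (e c) (e y)) ∨
    ∀ x ∈ A, ∀ y ∈ A, C y c x → C (e y) (e c) (e x) := by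
  have ir := h.limit.irrefl
  have hc := h.above
  have sy := h.limit.symm
  have asy := h.limit.asymm
  rcases h.three_options (τ := fun p x y => p = c ∧ x ∈ A ∧ y ∈ A ∧ C y c x)
    (by
      rintro _ x y ⟨rfl, a1, a2, d1⟩
      have l1 := h.lt_of_farther a2 d1
      grind)
    (by
      rintro _ y z _ y' z' ⟨rfl, a2, a3, d1⟩ ⟨rfl, a2', a3', d1'⟩
      exact h.canonical_pair a2 a3 a2' a3' (h.lt_of_farther a3 d1)
        (h.lt_of_farther a3' d1') (iff_of_false (by grind) (by grind))) with h0 | h0 | h0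
  · exact Or.inl fun x hx y hy d => h0 c x y ⟨rfl, hx, hy, d⟩
  · exact Or.inr (Or.inl fun x hx y hy d => h0 c x y ⟨rfl, hx, hy, d⟩)
  · exact Or.inr (Or.inr fun x hx y hy d => h0 c x y ⟨rfl, hx, hy, d⟩)

/-- Triples in three different cones all keep the farthest element on top, or all have the nearest
one on top. -/
theorem distinct_cones_triple (h : CanonicalAbove C lt c e A) :
    (∀ x ∈ A, ∀ y ∈ A, ∀ z ∈ A, C y c x → C z c y → C (e x) (e y) (e z)) ∨
    ∀ x ∈ A, ∀ y ∈ A, ∀ z ∈ A, C y c x → C z c y → C (e z) (e x) (e y) := by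
  classical
  have ir := h.limit.irrefl
  have tr := h.limit.trans
  have sy := h.limit.symm
  have asy := h.limit.asymm
  have cu := h.limit.cut
  have far : ∀ x y z, C y c x → C z c y → C z c x ∧ C z x y := by
    intro x y z h1 h2
    have h3 : C z c x := by grind
    exact ⟨h3, h.limit.join h3 h2⟩
  rcases h.three_options (τ := fun x y z => x ∈ A ∧ y ∈ A ∧ z ∈ A ∧ C y c x ∧ C z c y)
    (by
      rintro x y z ⟨a1, a2, a3, c1, d1⟩
      have l1 := h.lt_of_farther a2 c1
      have l2 := h.lt_of_farther a3 d1
      have l3 := tr _ _ _ l1 l2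
      grind)
    (by
      rintro x y z x' y' z' ⟨a1, a2, a3, c1, d1⟩ ⟨a1', a2', a3', c1', d1'⟩
      have f := far _ _ _ c1 d1
      have f' := far _ _ _ c1' d1'
      exact h.canonical_triple a1 a2 a3 a1' a2' a3' (h.lt_of_farther a2 c1)
        (h.lt_of_farther a3 d1) (h.lt_of_farther a2' c1') (h.lt_of_farther a3' d1')
        (iff_of_false (by grind) (by grind)) (iff_of_false (by grind) (by grind))
        (iff_of_false (by grind) (by grind)) (iff_of_false (by grind) (by grind)))
    with h0 | h0 | h0
  · exact Or.inl fun x hx y hy z hz c1 d1 => h0 x y z ⟨hx, hy, hz, c1, d1⟩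
  · exfalso
    -- a decreasing comb `q 0, …, q 4` whose deepest element `q 4` is sent to `c`
    obtain ⟨q, hq, hqc⟩ := h.limit.flip.exists_comb
    have hm : ∀ i < 5, q i ∈ (Finset.range 5).image q := fun i hi =>
      Finset.mem_image_of_mem _ (Finset.mem_range.2 hi)
    obtain ⟨β, hβ, hβc, hA⟩ := h.universal.exists_isAutCLt h.limit h.above
      ((Finset.range 5).image q) (u := q 4) (hm 4 (by omega)) (by
        intro x hx
        obtain ⟨i, hi, rfl⟩ := Finset.mem_image.1 hx
        have hi := Finset.mem_range.1 hi
        rcases (Nat.le_of_lt_succ hi).lt_or_eq with h1 | rfl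
        · exact Or.inr (hq _ _ h1)
        · exact Or.inl rfl)
    have hA' : ∀ i < 4, β (q i) ∈ A := by
      intro i hi
      refine (hA _ (hm i (by omega))).resolve_left fun h1 => ?_
      have := hq _ _ hi
      rw [h1] at this
      exact ir _ this
    have hC : ∀ i j, i < j → j < 4 → C (β (q i)) c (β (q j)) := by
      intro i j hij hj
      rw [← hβc]
      exact (hβ.1 _ _ _).2 (sy _ _ _ (hqc _ _ _ hij hj))
    have key : ∀ i j k, i < j → j < k → k < 4 →
        C (e (β (q j))) (e (β (q i))) (e (β (q k))) := fun i j k hij hjk hk =>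
      sy _ _ _ (h0 _ _ _ ⟨hA' k hk, hA' j (by omega), hA' i (by omega),
        hC j k hjk hk, hC i j hij (by omega)⟩)
    exact not_middle h.limit.toIsBinaryCRelation
      (key 0 1 2 (by omega) (by omega) (by omega)) (key 0 1 3 (by omega) (by omega) (by omega))
      (key 1 2 3 (by omega) (by omega) (by omega))
  · exact Or.inr fun x hx y hy z hz c1 d1 => h0 x y z ⟨hx, hy, hz, c1, d1⟩

end CanonicalAbove

end

section

variable {L : Type*} {C : L → L → L → Prop} {lt : L → L → Prop} {c : L} {e : L → L} {A : Set L}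

/-! ### Maps that respect cones -/

/-- The part of the behaviors `id_c` and `reroot_c` that concerns at most two cones: `e` preserves
`C` on cones, separates `c` from each cone, and separates cones from each other. -/
structure RespectsCones (C : L → L → L → Prop) (c : L) (e : L → L) (A : Set L) : Prop where
  rel : IsBinaryCRelation C
  injective : Function.Injective e
  const_notMem : c ∉ A
  cone : ∀ x ∈ A, ∀ y ∈ A, ∀ z ∈ A, C c x y → C c x z → C x y z → C (e x) (e y) (e z)
  const : ∀ x ∈ A, ∀ y ∈ A, C c x y → C (e c) (e x) (e y)
  near : ∀ x ∈ A, ∀ y ∈ A, ∀ z ∈ A, C c x y → C z c x → C (e z) (e x) (e y)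
  far : ∀ x ∈ A, ∀ y ∈ A, ∀ z ∈ A, C c y z → C y c x → C (e x) (e y) (e z)

/-- The position of `x | y z` relative to `c`. -/
theorem IsBinaryCRelation.rel_cases (h : IsBinaryCRelation C) {x y z : L} (hx : x ≠ c)
    (hy : y ≠ c) (hz : z ≠ c) (hyz : y ≠ z) (hC : C x y z) :
    (C c y z ∧ (C c x y ∨ C x c y ∨ C y c x)) ∨ (C x c z ∧ C z c y) ∨ (C x c y ∧ C y c z) := by
  obtain ⟨h1, h2, h3, h4, h5⟩ := h
  have n1 : x ≠ y := by grind
  have n2 : x ≠ z := by grind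
  have b1 := h5 c y z hy.symm hyz hz.symm
  have b2 := h5 c x y hx.symm n1 hy.symm
  have b3 := h5 c x z hx.symm n2 hz.symm
  grind

namespace RespectsCones

theorem ne_const (h : RespectsCones C c e A) {x : L} (hx : x ∈ A) : x ≠ c := by
  rintro rfl
  exact h.const_notMem hx

theorem oneConstBehavior (h : RespectsCones C c e A) : OneConstBehavior C c e A := by
  refine ⟨?_, ?_, ?_⟩
  · intro a ha
    constructor
    · rintro x rfl x' rfl _ ⟨y, ⟨hy, -⟩, rfl⟩
      exact h.rel.self _ _ (h.injective.ne (h.ne_const hy))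
    · rintro x rfl _ ⟨y, ⟨hy, -, hay⟩, rfl⟩ _ ⟨y', ⟨hy', -, hay'⟩, rfl⟩
      exact h.const y hy y' hy' (h.rel.join hay hay')
  · rintro a ha x ⟨hx, -, hax⟩ y ⟨hy, -, hay⟩ z ⟨hz, -, haz⟩ hC
    exact h.cone x hx y hy z hz (h.rel.join hax hay) (h.rel.join hax haz) hC
  · intro a ha b hb
    have key : ∀ a ∈ A, ∀ b ∈ A, C b c a → ∀ x ∈ A ∩ _root_.cone C c a,
        ∀ y ∈ A ∩ _root_.cone C c b, C y c x := by
      rintro a ha b hb hab x ⟨hx, -, hax⟩ y ⟨hy, -, hay⟩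
      obtain ⟨h1, h2, h3, h4, h5⟩ := h.rel
      grind
    have main : ∀ a ∈ A, ∀ b ∈ A, C b c a →
        SetSep C (e '' (A ∩ _root_.cone C c a)) (e '' (A ∩ _root_.cone C c b)) := by
      intro a ha b hb hab
      constructor
      · rintro _ ⟨x, hx, rfl⟩ _ ⟨x', hx', rfl⟩ _ ⟨y, hy, rfl⟩
        exact h.near x hx.1 x' hx'.1 y hy.1 (h.rel.join hx.2.2 hx'.2.2)
          (key a ha b hb hab x hx y hy)
      · rintro _ ⟨x, hx, rfl⟩ _ ⟨y, hy, rfl⟩ _ ⟨y', hy', rfl⟩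
        exact h.far x hx.1 y hy.1 y' hy'.1 (h.rel.join hy.2.2 hy'.2.2)
          (key a ha b hb hab x hx y hy)
    by_cases hab : C c a b
    · left
      ext x
      exact and_congr_right fun _ => ⟨fun hx => h.rel.join hab hx,
        fun hx => h.rel.join (h.rel.symm _ _ _ hab) hx⟩
    right
    have hne : a ≠ b := by
      rintro rfl
      exact hab (h.rel.self _ _ (h.ne_const ha).symm)
    rcases h.rel.binary c a b (h.ne_const ha).symm hne (h.ne_const hb).symm with h0 | h0 | h0
    · exact absurd h0 hab
    · exact (main b hb a ha h0).symm
    · exact main a ha b hb h0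

/-- If `e` puts the farther of two cones on top, then it keeps the order of the cones. -/
theorem behavesAsId (h : RespectsCones C c e A)
    (h1 : ∀ x ∈ A, ∀ y ∈ A, C y c x → C (e y) (e c) (e x)) : BehavesAsId C c e A := by
  refine ⟨h.oneConstBehavior, ?_⟩
  intro x hx y hy z hz hsep hyz
  have hxy : C x c y := hsep.2 x rfl c (by simp) y (by simp)
  have hxz : C x c z := hsep.2 x rfl c (by simp) z (by simp)
  have e1 := h1 _ hy _ hx hxy
  have e2 := h1 _ hz _ hx hxz
  have e3 := h1 _ hz _ hy (h.rel.symm _ _ _ hyz)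
  have e4 := h.rel.self _ _ (h.rel.ne_left e1)
  have sub : ∀ w ∈ ({e y, e z, e c} : Set L), C (e x) (e c) w := by
    rintro w (rfl | rfl | rfl)
    · exact e1
    · exact e2
    · exact e4
  refine ⟨⟨?_, ?_⟩, h.rel.symm _ _ _ e3⟩
  · rintro _ rfl _ rfl w hw
    exact h.rel.self _ _ (Ne.symm (h.rel.ne_right (sub w hw)))
  · rintro _ rfl w hw w' hw'
    exact h.rel.join (sub w hw) (sub w' hw')

/-- If `e` puts `c` on top, and below it the nearer cones above the farther ones, then it reroots
the tree at `c`. -/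
theorem behavesAsReroot (h : RespectsCones C c e A)
    (h1 : ∀ x ∈ A, ∀ y ∈ A, C y c x → C (e c) (e x) (e y))
    (h2 : ∀ x ∈ A, ∀ y ∈ A, ∀ z ∈ A, C y c x → C z c y → C (e x) (e y) (e z)) :
    BehavesAsReroot C c e A := by
  refine ⟨h.oneConstBehavior, ?_⟩
  intro x hx y hy z hz hsep hyz
  have hxy : C x c y := hsep.2 x rfl c (by simp) y (by simp)
  have hxz : C x c z := hsep.2 x rfl c (by simp) z (by simp)
  have hyz' := h.rel.symm _ _ _ hyz
  have e1 := h1 _ hy _ hx hxy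
  have e2 := h1 _ hz _ hx hxz
  have e3 := h.rel.self _ _ (h.rel.ne_right e1)
  have sub : ∀ w ∈ ({e x, e y, e z} : Set L), C (e c) (e x) w := by
    rintro w (rfl | rfl | rfl)
    · exact e3
    · exact h.rel.symm _ _ _ e1
    · exact h.rel.symm _ _ _ e2
  refine ⟨⟨?_, ?_⟩, h.rel.symm _ _ _ (h2 _ hz _ hy _ hx hyz' hxy)⟩
  · rintro w hw w' hw' _ rfl
    exact h.rel.join (sub w hw) (sub w' hw')
  · rintro w hw _ rfl _ rfl
    exact h.rel.self _ _ (Ne.symm (h.rel.ne_right (sub w hw)))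

/-- If `e` moves `c` to the top and preserves `C` on `A`, then any leaf can be moved to the top. -/
theorem generatesCombs_of_lift (h : RespectsCones C c e A) (hlt : IsOrderedLeafStructure C lt)
    (hA : IsUniversalAt C c A)
    (h1 : ∀ x ∈ A, ∀ y ∈ A, C y c x → C (e c) (e x) (e y))
    (h2 : ∀ x ∈ A, ∀ y ∈ A, ∀ z ∈ A, C y c x → C z c y → C (e z) (e x) (e y)) :
    GeneratesCombs C lt ({e} ∪ autC C) := by
  have hM := injective_of_mem_generators (C := C) h.injective
  have pres : ∀ x ∈ A, ∀ y ∈ A, ∀ z ∈ A, C x y z → C (e x) (e y) (e z) := by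
    intro x hx y hy z hz hC
    by_cases hyz : y = z
    · subst hyz
      exact h.rel.self _ _ (h.injective.ne (h.rel.ne_left hC))
    rcases h.rel.rel_cases (h.ne_const hx) (h.ne_const hy) (h.ne_const hz) hyz hC with
      ⟨c1, c2 | c2 | c2⟩ | ⟨c1, c2⟩ | ⟨c1, c2⟩
    · exact h.cone x hx y hy z hz c2
        (h.rel.join (h.rel.symm _ _ _ c2) c1) hC
    · exact h.near y hy z hz x hx c1 c2
    · exact h.far x hx y hy z hz c1 c2
    · exact h2 y hy z hz x hx c2 c1
    · exact h.rel.symm _ _ _ (h2 z hz y hy x hx c2 c1)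
  have top : ∀ x ∈ A, ∀ y ∈ A, C (e c) (e x) (e y) := by
    intro x hx y hy
    by_cases hxy : x = y
    · subst hxy
      exact h.rel.self _ _ (h.injective.ne (h.ne_const hx).symm)
    rcases h.rel.binary c x y (h.ne_const hx).symm hxy (h.ne_const hy).symm with h0 | h0 | h0
    · exact h.const x hx y hy h0
    · exact h.rel.symm _ _ _ (h1 y hy x hx h0)
    · exact h1 x hx y hy h0
  refine generatesCombs_of_pull hlt hM fun F u hu => ?_
  obtain ⟨α, hα, hαu, hαF⟩ := hA.2 F u hu
  have hαA : ∀ x ∈ F, x ≠ u → α x ∈ A := fun x hx hxu =>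
    (hαF x hx).resolve_left fun h0 => hxu (α.injective (h0.trans hαu.symm))
  refine ⟨e ∘ α, comp_aut_mem_closure hα, ?_, ?_⟩
  · intro y hy hyu z hz hzu
    simp only [Function.comp_apply, hαu]
    exact top _ (hαA y hy hyu) _ (hαA z hz hzu)
  · intro x hx hxu y hy hyu z hz hzu hC
    exact pres _ (hαA x hx hxu) _ (hαA y hy hyu) _ (hαA z hz hzu) ((hα _ _ _).2 hC)

/-- If `e` keeps `c` at the bottom and reverses the order of the cones, then any leaf can be moved
to the top: a first application of `e` with the leaf in the place of `c` reverses the path from the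
leaf to the root, and a second one, with a new leaf next to it in the place of `c`, reverses it
again but moves the leaf to the top. -/
theorem generatesCombs_of_reverse (h : RespectsCones C c e A) (hlt : IsOrderedLeafStructure C lt)
    (hbr : Branching C lt) (hA : IsUniversalAt C c A)
    (h1 : ∀ x ∈ A, ∀ y ∈ A, C y c x → C (e x) (e c) (e y)) :
    GeneratesCombs C lt ({e} ∪ autC C) := by
  classical
  have hM := injective_of_mem_generators (C := C) h.injective
  have sy := h.rel.symm
  refine generatesCombs_of_pull hlt hM fun F u hu => ?_
  obtain ⟨α, hα, hαu, hαF⟩ := hA.2 F u hu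
  have hαA : ∀ x ∈ F, x ≠ u → α x ∈ A := fun x hx hxu =>
    (hαF x hx).resolve_left fun h0 => hxu (α.injective (h0.trans hαu.symm))
  -- `v` is a new leaf next to the image `e c` of `u`
  obtain ⟨v, hv, hvO, -, -⟩ := hbr (e c) ((F.erase u).image (e ∘ α)) {e c} (by
      intro b hb
      obtain ⟨x, hx, rfl⟩ := Finset.mem_image.1 hb
      have hx := Finset.mem_erase.1 hx
      exact h.injective.ne (h.ne_const (hαA x hx.2 hx.1))) (by
      intro b hb g hg
      obtain ⟨x, hx, rfl⟩ := Finset.mem_image.1 hb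
      have hx := Finset.mem_erase.1 hx
      rw [Finset.mem_singleton.1 hg]
      exact h.rel.self _ _ (h.injective.ne (h.ne_const (hαA x hx.2 hx.1)))) True
  have hvF : ∀ x ∈ F, x ≠ u → C (e (α x)) (e c) v := fun x hx hxu =>
    hvO _ (Finset.mem_image_of_mem (e ∘ α) (Finset.mem_erase.2 ⟨hxu, hx⟩))
  have hvne : ∀ x ∈ F, e (α x) ≠ v := by
    intro x hx h0
    by_cases hxu : x = u
    · rw [hxu, hαu] at h0
      exact hv h0.symm
    · exact h.rel.ne_right (hvF x hx hxu) h0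
  obtain ⟨β, hβ, hβv, hβF⟩ := hA.2 (insert v (F.image (e ∘ α))) v (by simp)
  have hβA : ∀ x ∈ F, β (e (α x)) ∈ A := fun x hx =>
    (hβF _ (Finset.mem_insert_of_mem (Finset.mem_image_of_mem (e ∘ α) hx))).resolve_left
      fun h0 => hvne x hx (β.injective (h0.trans hβv.symm))
  -- elements of the same cone stay in the same cone
  have same : ∀ x ∈ F, x ≠ u → ∀ y ∈ F, y ≠ u → C c (α x) (α y) →
      C c (β (e (α x))) (β (e (α y))) := by
    intro x hx hxu y hy hyu hC
    have e1 := h.const _ (hαA x hx hxu) _ (hαA y hy hyu) hC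
    have e2 := hvF x hx hxu
    have e3 := hvF y hy hyu
    rw [← hβv]
    refine (hβ _ _ _).2 ?_
    have h3 := h.rel.cut
    have h4 := h.rel.asymm
    grind
  -- elements of different cones exchange their positions
  have swap : ∀ x ∈ F, x ≠ u → ∀ y ∈ F, y ≠ u → C (α y) c (α x) →
      C (β (e (α x))) c (β (e (α y))) := by
    intro x hx hxu y hy hyu hC
    rw [← hβv]
    exact (hβ _ _ _).2 (h.rel.join (hvF x hx hxu) (h1 _ (hαA x hx hxu) _ (hαA y hy hyu) hC))
  have huA := hβA u hu
  refine ⟨(e ∘ β) ∘ (e ∘ α), comp_mem_closure (comp_aut_mem_closure hβ)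
    (comp_aut_mem_closure hα), ?_, ?_⟩
  · intro y hy hyu z hz hzu
    have key : ∀ y ∈ F, y ≠ u → C (e (β (e (α u)))) (e c) (e (β (e (α y)))) := by
      intro y hy hyu
      refine h1 _ huA _ (hβA y hy) ?_
      rw [← hβv, hαu]
      exact (hβ _ _ _).2 (sy _ _ _ (hvF y hy hyu))
    exact h.rel.join (key y hy hyu) (key z hz hzu)
  · intro x hx hxu y hy hyu z hz hzu hC
    by_cases hyz : y = z
    · subst hyz
      exact h.rel.self _ _ (h.injective.ne (β.injective.ne (h.injective.ne (α.injective.ne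
        (h.rel.ne_left hC)))))
    have xA := hαA x hx hxu
    have yA := hαA y hy hyu
    have zA := hαA z hz hzu
    have hC' := (hα _ _ _).2 hC
    rcases h.rel.rel_cases (h.ne_const xA) (h.ne_const yA) (h.ne_const zA)
      (α.injective.ne hyz) hC' with ⟨c1, c2 | c2 | c2⟩ | ⟨c1, c2⟩ | ⟨c1, c2⟩
    · have c3 := h.rel.join (sy _ _ _ c2) c1
      exact h.cone _ (hβA x hx) _ (hβA y hy) _ (hβA z hz) (same x hx hxu y hy hyu c2)
        (same x hx hxu z hz hzu c3) ((hβ _ _ _).2 (h.cone _ xA _ yA _ zA c2 c3 hC'))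
    · exact h.far _ (hβA x hx) _ (hβA y hy) _ (hβA z hz) (same y hy hyu z hz hzu c1)
        (swap y hy hyu x hx hxu c2)
    · exact h.near _ (hβA y hy) _ (hβA z hz) _ (hβA x hx) (same y hy hyu z hz hzu c1)
        (swap x hx hxu y hy hyu c2)
    -- `x` lies in the farthest of three cones, so its first image is the nearest one
    all_goals
      have c3 : C (α x) c (α y) ∧ C (α x) c (α z) := by
        have h3 := h.rel.cut
        have h4 := h.rel.asymm
        grind
      exact h.rel.join (h1 _ (hβA x hx) _ (hβA y hy) (swap y hy hyu x hx hxu c3.1))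
        (h1 _ (hβA x hx) _ (hβA z hz) (swap z hz hzu x hx hxu c3.2))

end RespectsCones

/-! ### The trichotomy -/

theorem CanonicalAbove.trichotomy (h : CanonicalAbove C lt c e A) :
    GeneratesCombs C lt ({e} ∪ autC C) ∨ BehavesAsId C c e A ∨ BehavesAsReroot C c e A := by
  by_cases hn : GeneratesCombs C lt ({e} ∪ autC C)
  · exact Or.inl hn
  have hr : RespectsCones C c e A := ⟨h.limit.toIsBinaryCRelation, h.injective, h.universal.1,
    h.cone_preserves hn, h.pair_preserves hn, h.near_preserves hn, h.far_preserves hn⟩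
  rcases h.distinct_cones_pair with h1 | h1 | h1
  · rcases h.distinct_cones_triple with h2 | h2
    · exact Or.inr (Or.inr (hr.behavesAsReroot h1 h2))
    · exact absurd (hr.generatesCombs_of_lift h.limit.toIsOrderedLeafStructure h.universal h1 h2) hn
  · exact absurd (hr.generatesCombs_of_reverse h.limit.toIsOrderedLeafStructure h.limit.branching
      h.universal h1) hn
  · exact Or.inr (Or.inl (hr.behavesAsId h1))

end

theorem mainTheorem5 {L : Type*} (C : L → L → L → Prop) (lt : L → L → Prop)
    (hL : IsOrderedLeafLimit C lt) (c : L) (A : Set L)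
    (hside : A ⊆ {x | lt x c} ∨ A ⊆ {x | lt c x})
    (hA : IsUniversalAt C c A)
    (e : L → L) (he : Function.Injective e)
    (hcan : CanonicalOnWithConst C lt c e A) :
    GeneratesLin C lt ({e} ∪ autC C) ∨ BehavesAsId C c e A ∨ BehavesAsReroot C c e A := by
  have fin : GeneratesCombs C lt ({e} ∪ autC C) → GeneratesLin C lt ({e} ∪ autC C) :=
    fun h => h.generatesLin hL Set.subset_union_right (injective_of_mem_generators he)
  rcases hside with hs | hs
  -- if `A` lies below `c`, the order is reversed
  · have h : CanonicalAbove C (flip lt) c e A := by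
      refine ⟨hL.flip, fun x hx => hs hx, hA, he, ?_⟩
      intro n t ht α hα hαt
      obtain ⟨β, hβ, hβe⟩ := hcan n t ht α ⟨isAutCLt_flip.1 hα.1, hα.2⟩ hαt
      exact ⟨β, isAutCLt_flip.2 hβ, hβe⟩
    exact h.trichotomy.imp_left fun h0 => fin (h0.of_flip hL Set.subset_union_right)
  · exact CanonicalAbove.trichotomy ⟨hL, fun x hx => hs hx, hA, he, hcan⟩ |>.imp_left fin
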